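/- Throughout, $A\approx B$ means $cB\le A\le CB$ with positive constants $c,C$ independent of the variable ($t>0$, or the function $f$), and $\|\cdot\|_{q,(a,b)}$ is the $L^q$-quasi-norm on $(a,b)$. A Lebesgue measurable $b:(0,\infty)\to(0,\infty)$ is slowly varying, $b\in SV$, if for every $\varepsilon>0$ the functions $t^{\varepsilon}b(t)$ and $t^{-\varepsilon}b(t)$ are equivalent ($\approx$) on $(0,\infty)$ to a positive non-decreasing and a positive non-increasing function, respectively; $b\in SV_{0,q}$ if moreover $\|u^{-1/q}b(u)\|_{q,(1,\infty)}<\infty$. For two spaces $A_0,A_1$ with semi-quasi-norms inside a common vector space, put $$K(t,f;A_0,A_1)=\inf\{\|f_0\|_{A_0}+t\|f_1\|_{A_1}: f=f_0+f_1,\ f_j\in A_j\},$$ and let $(A_0,A_1)_{\theta,q;b}$ be the space of all $f\in A_0+A_1$ for which $\|f\|_{\theta,q;b}=\|t^{-\theta-1/q}b(t)K(t,f;A_0,A_1)\|_{q,(0,\infty)}$ is finite. Let $E$ be a rearrangement-invariant Banach function space on $\mathbb{R}^n$ (in the sense of Bennett and Sharpley), and let $\omega_E(f,t)=\sup_{|h|\le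 t}\|f(\cdot+h)-f\|_E$ for $f\in E$. For $0<q<\infty$ and a positive weight $b$ on $(0,\infty)$, the homogeneous Besov space $B^{0,b}_{E,q}$ consists of all $f\in E$ for which the semi-quasi-norm $$\|f\|_{B^{0,b}_{E,q}}=\|t^{-1/q}b(t)\,\omega_E(f,t)\|_{q,(0,\infty)}$$ is finite. **Theorem.** Let $0<q_0,q_1,q<\infty$ with $q_0\ne q_1$, let $0<\theta<1$, $b_j\in SV_{0,q_j}$ $(j=0,1)$ and $b\in SV$. Put $$\rho(t)=\frac{\|u^{-1/q_0}b_0(u)\|_{q_0,(t,\infty)}}{\|u^{-1/q_1}b_1(u)\|_{q_1,(t,\infty)}},\qquad \rho_\epsilon(t)=\frac{\|u^{-1/q_0}b_0(u)\|_{q_0,(t,\infty)}^{1+\epsilon}}{\|u^{-1/q_1}b_1(u)\|_{q_1,(t,\infty)}}\qquad(t>0).$$ Assume that for some $\epsilon>0$ the function $\rho_\epsilon$ is equivalent to a non-decreasing function on $(0,\infty)$, and that $\rho$ is non-decreasing on $(0,\infty)$ with $\lim_{t\to0^+}\rho(t)=0$ and $\lim_{t\to\infty}\rho(t)=\infty$.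 Let $$\tilde b(t)=[\rho(t)]^{1-\theta}\,b(\rho(t))\,[b_1(t)]^{q_1/q}\left(\int_t^\infty b_1^{q_1}(u)\frac{du}{u}\right)^{1/q_1-1/q},\qquad t>0.$$ Then $$\left(B^{0,b_0}_{E,q_0},\,B^{0,b_1}_{E,q_1}\right)_{\theta,q;b}=B^{0,\tilde b}_{E,q},$$ that is, both spaces consist of the same functions, and their semi-quasi-norms are equivalent. -/

import Mathlib

open MeasureTheory Set Filter Topology
open scoped ENNReal NNReal Pointwise

noncomputable section

namespace LimitingInterpolation

/-! ### Slowly varying functions -/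

/-- `f ≈ g` on `(0, ∞)`. -/
def EquivPos (f g : ℝ → ℝ) : Prop :=
  ∃ c C : ℝ, 0 < c ∧ 0 < C ∧ ∀ t, 0 < t → c * g t ≤ f t ∧ f t ≤ C * g t

/-- The class `SV` of slowly varying functions `b : (0, ∞) → (0, ∞)`. Such a function is
represented by a function on `ℝ`, whose values on `(-∞, 0]` play no role. Almost everywhere
measurability with respect to Lebesgue measure is Lebesgue measurability. -/
structure SlowlyVarying (b : ℝ → ℝ) : Prop where
  aemeasurable : AEMeasurable b (volume.restrict (Ioi 0))
  pos : ∀ t, 0 < t → 0 < b t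
  equiv_monotone : ∀ ε : ℝ, 0 < ε → ∃ g : ℝ → ℝ, (∀ t, 0 < t → 0 < g t) ∧
    MonotoneOn g (Ioi 0) ∧ EquivPos (fun t => t ^ ε * b t) g
  equiv_antitone : ∀ ε : ℝ, 0 < ε → ∃ g : ℝ → ℝ, (∀ t, 0 < t → 0 < g t) ∧
    AntitoneOn g (Ioi 0) ∧ EquivPos (fun t => t ^ (-ε) * b t) g

/-- The class `SV_{0,q}` (`0 < q < ∞`): slowly varying `b` with
`‖u ^ (-1/q) b(u)‖_{q,(1,∞)} < ∞`. -/
structure SlowlyVaryingZero (q : ℝ) (b : ℝ → ℝ) : Prop extends SlowlyVarying b where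
  tail_lt_top :
    eLpNorm' (fun u : ℝ => u ^ (-(1 / q)) * b u) q (volume.restrict (Ioi 1)) < ∞

/-- The number `‖u ^ (-1/q) b(u)‖_{q,(t,∞)}`, finite for `b ∈ SV_{0,q}` and `t > 0`. -/
def tailNorm (q : ℝ) (b : ℝ → ℝ) (t : ℝ) : ℝ :=
  (eLpNorm' (fun u : ℝ => u ^ (-(1 / q)) * b u) q (volume.restrict (Ioi t))).toReal

/-- `ρ(t) = ‖u ^ (-1/q₀) b₀(u)‖_{q₀,(t,∞)} / ‖u ^ (-1/q₁) b₁(u)‖_{q₁,(t,∞)}`. -/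
def rho (q₀ q₁ : ℝ) (b₀ b₁ : ℝ → ℝ) (t : ℝ) : ℝ :=
  tailNorm q₀ b₀ t / tailNorm q₁ b₁ t

/-- `ρ_ε(t) = ‖u ^ (-1/q₀) b₀(u)‖_{q₀,(t,∞)} ^ (1+ε) / ‖u ^ (-1/q₁) b₁(u)‖_{q₁,(t,∞)}`. -/
def rhoEps (ε q₀ q₁ : ℝ) (b₀ b₁ : ℝ → ℝ) (t : ℝ) : ℝ :=
  tailNorm q₀ b₀ t ^ (1 + ε) / tailNorm q₁ b₁ t

/-- For some `ε > 0`, the function `ρ_ε` is equivalent to a non-decreasing function. -/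
def RhoCondition (q₀ q₁ : ℝ) (b₀ b₁ : ℝ → ℝ) : Prop :=
  ∃ ε : ℝ, 0 < ε ∧ ∃ g : ℝ → ℝ, MonotoneOn g (Ioi 0) ∧ EquivPos (rhoEps ε q₀ q₁ b₀ b₁) g

/-- The weight `b̃` of the interpolated space. -/
def bTilde (θ q q₀ q₁ : ℝ) (b b₀ b₁ : ℝ → ℝ) (t : ℝ) : ℝ :=
  rho q₀ q₁ b₀ b₁ t ^ (1 - θ) * b (rho q₀ q₁ b₀ b₁ t) * b₁ t ^ (q₁ / q) *
    (∫ u in Ioi t, b₁ u ^ q₁ / u) ^ (1 / q₁ - 1 / q)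

/-! ### The `K`-method for spaces `A₀, A₁ ⊆ V` with semi-quasi-norms `N₀, N₁` -/

section KMethod

variable {V : Type*} [AddCommGroup V]

/-- `K(t, f; A₀, A₁)`, equal to `∞` if `f ∉ A₀ + A₁`. -/
def kFunctional (A₀ A₁ : Set V) (N₀ N₁ : V → ℝ≥0∞) (t : ℝ) (f : V) : ℝ≥0∞ :=
  ⨅ (f₀ ∈ A₀) (f₁ ∈ A₁) (_ : f = f₀ + f₁), N₀ f₀ + ENNReal.ofReal t * N₁ f₁

/-- The semi-quasi-norm `‖t ^ (-θ-1/q) b(t) K(t, f; A₀, A₁)‖_{q,(0,∞)}`. -/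
def kInterpNorm (A₀ A₁ : Set V) (N₀ N₁ : V → ℝ≥0∞) (θ q : ℝ) (b : ℝ → ℝ) (f : V) : ℝ≥0∞ :=
  eLpNorm' (fun t : ℝ => ENNReal.ofReal (t ^ (-θ - 1 / q) * b t) * kFunctional A₀ A₁ N₀ N₁ t f)
    q (volume.restrict (Ioi 0))

/-- The `K`-interpolation space `(A₀, A₁)_{θ,q;b}`. -/
def kInterpSpace (A₀ A₁ : Set V) (N₀ N₁ : V → ℝ≥0∞) (θ q : ℝ) (b : ℝ → ℝ) : Set V :=
  {f | f ∈ A₀ + A₁ ∧ kInterpNorm A₀ A₁ N₀ N₁ θ q b f < ∞}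

end KMethod

/-! ### Rearrangement-invariant Banach function spaces on `ℝⁿ` -/

/-- A rearrangement-invariant Banach function norm on `ℝⁿ` with Lebesgue measure, in the sense of
Bennett and Sharpley: a functional on the nonnegative extended-valued measurable functions
(its values at non-measurable functions play no role). -/
structure RIFunctionNorm (n : ℕ) where
  toFun : (EuclideanSpace ℝ (Fin n) → ℝ≥0∞) → ℝ≥0∞
  eq_zero_iff : ∀ f, AEMeasurable f volume → (toFun f = 0 ↔ f =ᵐ[volume] 0)
  const_mul : ∀ (a : ℝ≥0) (f), AEMeasurable f volume →
    toFun (fun x => (a : ℝ≥0∞) * f x) = (a : ℝ≥0∞) * toFun f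
  add_le : ∀ f g, AEMeasurable f volume → AEMeasurable g volume →
    toFun (fun x => f x + g x) ≤ toFun f + toFun g
  mono : ∀ f g, AEMeasurable f volume → AEMeasurable g volume →
    f ≤ᵐ[volume] g → toFun f ≤ toFun g
  fatou : ∀ f : ℕ → EuclideanSpace ℝ (Fin n) → ℝ≥0∞, (∀ k, AEMeasurable (f k) volume) →
    (∀ᵐ x ∂volume, Monotone fun k => f k x) → toFun (fun x => ⨆ k, f k x) = ⨆ k, toFun (f k)
  indicator_lt_top : ∀ S : Set (EuclideanSpace ℝ (Fin n)), MeasurableSet S → volume S < ∞ →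
    toFun (S.indicator fun _ => 1) < ∞
  lintegral_le : ∀ S : Set (EuclideanSpace ℝ (Fin n)), MeasurableSet S → volume S < ∞ →
    ∃ C : ℝ≥0, ∀ f, AEMeasurable f volume → ∫⁻ x in S, f x ≤ C * toFun f
  rearrangement_invariant : ∀ f g, AEMeasurable f volume → AEMeasurable g volume →
    (∀ᵐ x ∂volume, f x < ∞) → (∀ᵐ x ∂volume, g x < ∞) →
    (∀ s : ℝ≥0, volume {x | (s : ℝ≥0∞) < f x} = volume {x | (s : ℝ≥0∞) < g x}) →
    toFun f = toFun g

section Besov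

variable {n : ℕ} {𝕜 : Type*} [RCLike 𝕜]

/-- The space `E` of (classes of) measurable functions determined by the norm. -/
def RIFunctionNorm.space (E : RIFunctionNorm n) (𝕜 : Type*) [RCLike 𝕜] :
    Set (EuclideanSpace ℝ (Fin n) →ₘ[volume] 𝕜) :=
  {f | E.toFun (fun x => ‖f x‖ₑ) < ∞}

/-- The modulus of continuity `ω_E(f, t) = sup_{|h| ≤ t} ‖f(· + h) - f‖_E`. -/
def modulus (E : RIFunctionNorm n) (f : EuclideanSpace ℝ (Fin n) →ₘ[volume] 𝕜) (t : ℝ) : ℝ≥0∞ :=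
  ⨆ (h : EuclideanSpace ℝ (Fin n)) (_ : ‖h‖ ≤ t), E.toFun fun x => ‖f (x + h) - f x‖ₑ

/-- The semi-quasi-norm `‖t ^ (-1/q) b(t) ω_E(f, t)‖_{q,(0,∞)}`. -/
def besovNorm (E : RIFunctionNorm n) (q : ℝ) (b : ℝ → ℝ)
    (f : EuclideanSpace ℝ (Fin n) →ₘ[volume] 𝕜) : ℝ≥0∞ :=
  eLpNorm' (fun t : ℝ => ENNReal.ofReal (t ^ (-(1 / q)) * b t) * modulus E f t)
    q (volume.restrict (Ioi 0))

/-- The homogeneous Besov space `B^{0,b}_{E,q}`. -/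
def besovSpace (E : RIFunctionNorm n) (𝕜 : Type*) [RCLike 𝕜] (q : ℝ) (b : ℝ → ℝ) :
    Set (EuclideanSpace ℝ (Fin n) →ₘ[volume] 𝕜) :=
  {f | f ∈ E.space 𝕜 ∧ besovNorm E q b f < ∞}

end Besov

end LimitingInterpolation

end

/-!
Let `T_j` be the tail norm of `b_j` and `ω` the modulus of continuity of `f`.

For monotone `ω`, the part of the `B^{0,b_j}_{E,q_j}`-norm over `(t, ∞)` is at least `T_j(t) ω(t)`;
as `T₀ = ρ T₁`, subadditivity of `ω` gives `T₀(t) ω(t) ≤ K(ρ(t), f)`. Conversely, if `g` is the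
mollification of `f` at scale `t`, the modulus of `f - g` at `u` is at most a multiple of
`ω(min(u, t))`, and that of `g` at most a multiple of `ω(u)` for `u > t` and of `(u / t) ω(t)` for
`u ≤ t`. The splitting `f = (f - g) + g` therefore bounds `K(ρ(t), f)` by integrals of `ω` against
`b₀` over `(0, t)` and against `b₁` over `(t, ∞)`, as in Holmstedt's formula.

Choose `t_k` with `ρ(t_k) = 2^k`. As `T₀` is non-increasing, `T₁` at least halves from `t_k` to
`t_{k+1}`, and the condition on `ρ_ε` prevents a drop by more than a constant factor. So both
integrals become sums of the values `T_j(t_k) ω(t_k)`, while the norms of the two spaces become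
`ℓ^q`-norms over `k`, with weights `2^{-θk} b(2^k)` for the `K`-functional and `2^{(1-θ)k} b(2^k)
T₁(t_k)` for `ω`. Since `0 < θ < 1`, the weights `2^{-θk} b(2^k)` decay and `2^{(1-θ)k} b(2^k)` grow
geometrically, and a discrete Hardy inequality absorbs the sums.
-/

namespace LimitingInterpolation

section Sampling

variable {H : Type*} [MeasurableSpace H] (ν : Measure H) [IsProbabilityMeasure ν]

theorem ae_tendsto_average_infinitePi {φ : H → ℝ} (hφ : Measurable φ) (hint : Integrable φ ν) :
    ∀ᵐ ω ∂Measure.infinitePi fun _ : ℕ => ν,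
      Tendsto (fun N : ℕ => (∑ i ∈ Finset.range N, φ (ω i)) / N) atTop (𝓝 (∫ h, φ h ∂ν)) := by
  have heval := measurePreserving_eval_infinitePi fun _ : ℕ => ν
  have hident (i : ℕ) : ProbabilityTheory.IdentDistrib (fun ω : ℕ → H => φ (ω i))
      (fun ω => φ (ω 0)) (Measure.infinitePi fun _ => ν) (Measure.infinitePi fun _ => ν) :=
    ProbabilityTheory.IdentDistrib.comp ⟨(heval i).aemeasurable, (heval 0).aemeasurable,
      (heval i).map_eq.trans (heval 0).map_eq.symm⟩ hφ
  have hindep := ProbabilityTheory.iIndepFun_infinitePi (P := fun _ : ℕ => ν) (X := fun _ => φ)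
    fun _ => hφ
  have hmean : ∫ ω, φ (ω 0) ∂(Measure.infinitePi fun _ : ℕ => ν) = ∫ h, φ h ∂ν := by
    conv_rhs => rw [← (heval 0).map_eq]
    exact (integral_map (heval 0).aemeasurable hφ.aestronglyMeasurable).symm
  rw [← hmean]
  exact ProbabilityTheory.strong_law_ae_real (μ := Measure.infinitePi fun _ : ℕ => ν)
    (fun i ω => φ (ω i)) ((heval 0).integrable_comp_of_integrable hint)
    (fun i j hij => hindep.indepFun hij) hident

theorem ae_tendsto_ennreal_average_infinitePi {φ : H → ℝ≥0∞} (hφ : Measurable φ)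
    (hfin : ∫⁻ h, φ h ∂ν ≠ ∞) :
    ∀ᵐ ω ∂Measure.infinitePi fun _ : ℕ => ν,
      Tendsto (fun N : ℕ => ((N : ℝ≥0)⁻¹ : ℝ≥0) * ∑ i ∈ Finset.range N, φ (ω i)) atTop
        (𝓝 (∫⁻ h, φ h ∂ν)) := by
  have hlt : ∀ᵐ h ∂ν, φ h < ∞ := ae_lt_top hφ hfin
  have hlt_sample : ∀ᵐ ω ∂Measure.infinitePi fun _ : ℕ => ν, ∀ i, φ (ω i) < ∞ :=
    ae_all_iff.2 fun i =>
      (measurePreserving_eval_infinitePi (fun _ => ν) i).quasiMeasurePreserving.ae hlt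
  filter_upwards [hlt_sample, ae_tendsto_average_infinitePi ν hφ.ennreal_toReal
    (integrable_toReal_of_lintegral_ne_top hφ.aemeasurable hfin)] with ω hω hlim
  rw [integral_toReal hφ.aemeasurable hlt] at hlim
  rw [← ENNReal.ofReal_toReal hfin]
  refine (ENNReal.tendsto_ofReal hlim).congr fun N => ?_
  rw [div_eq_inv_mul, ENNReal.ofReal_mul (by positivity),
    ENNReal.ofReal_sum_of_nonneg fun _ _ => ENNReal.toReal_nonneg,
    Finset.sum_congr rfl fun i _ => ENNReal.ofReal_toReal (hω i).ne, ← NNReal.coe_natCast,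
    ← NNReal.coe_inv, ENNReal.ofReal_coe_nnreal]

end Sampling

namespace RIFunctionNorm

variable {n : ℕ} (E : RIFunctionNorm n)

theorem toFun_congr_ae {f g : EuclideanSpace ℝ (Fin n) → ℝ≥0∞}
    (hf : AEMeasurable f volume) (h : f =ᵐ[volume] g) : E.toFun f = E.toFun g :=
  le_antisymm (E.mono f g hf (hf.congr h) h.le) (E.mono g f (hf.congr h) hf h.symm.le)

theorem toFun_zero : E.toFun (fun _ => 0) = 0 :=
  (E.eq_zero_iff _ aemeasurable_const).2 (Eventually.of_forall fun _ => rfl)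

theorem toFun_sum_le {ι : Type*} (s : Finset ι) (g : ι → EuclideanSpace ℝ (Fin n) → ℝ≥0∞)
    (hg : ∀ i, AEMeasurable (g i) volume) :
    E.toFun (fun x => ∑ i ∈ s, g i x) ≤ ∑ i ∈ s, E.toFun (g i) := by
  classical
  induction s using Finset.induction_on with
  | empty => simp [E.toFun_zero]
  | insert a s ha ih =>
    simp only [Finset.sum_insert ha]
    exact (E.add_le _ _ (hg a) (Finset.aemeasurable_fun_sum _ fun i _ => hg i)).trans
      (by gcongr)

theorem toFun_average_le (N : ℕ) (g : ℕ → EuclideanSpace ℝ (Fin n) → ℝ≥0∞)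
    (hg : ∀ i, AEMeasurable (g i) volume) {M : ℝ≥0∞} (hM : ∀ i, E.toFun (g i) ≤ M) :
    E.toFun (fun x => ((N : ℝ≥0)⁻¹ : ℝ≥0) * ∑ i ∈ Finset.range N, g i x) ≤ M := by
  rw [E.const_mul _ _ (Finset.aemeasurable_fun_sum _ fun i _ => hg i)]
  have hsum : E.toFun (fun x => ∑ i ∈ Finset.range N, g i x) ≤ N * M := by
    refine (E.toFun_sum_le _ g hg).trans ?_
    simpa using Finset.sum_le_card_nsmul (Finset.range N) _ M fun i _ => hM i
  calc (((N : ℝ≥0)⁻¹ : ℝ≥0) : ℝ≥0∞) * E.toFun (fun x => ∑ i ∈ Finset.range N, g i x)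
      ≤ ((N : ℝ≥0)⁻¹ : ℝ≥0) * ((N : ℝ≥0) * M) := by gcongr; simpa using hsum
    _ = ((N : ℝ≥0)⁻¹ * N : ℝ≥0) * M := by rw [ENNReal.coe_mul, mul_assoc]
    _ ≤ M := mul_le_of_le_one_left' (by exact_mod_cast inv_mul_le_one)

theorem toFun_liminf_le {u : ℕ → EuclideanSpace ℝ (Fin n) → ℝ≥0∞}
    (hu : ∀ k, AEMeasurable (u k) volume) :
    E.toFun (fun x => liminf (fun k => u k x) atTop) ≤ liminf (fun k => E.toFun (u k)) atTop := by
  have hmeas (k : ℕ) : AEMeasurable (fun x => ⨅ i ≥ k, u i x) volume :=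
    AEMeasurable.biInf _ (to_countable {i | i ≥ k}) fun i _ => hu i
  have hmono (x) : Monotone fun k => ⨅ i ≥ k, u i x :=
    fun _ _ hkl => biInf_mono fun _ => hkl.trans
  simp only [liminf_eq_iSup_iInf_of_nat]
  rw [E.fatou _ hmeas (Eventually.of_forall hmono)]
  exact iSup_mono fun k => le_iInf₂ fun i hi => E.mono _ _ (hmeas k) (hu i)
    (Eventually.of_forall fun x => iInf₂_le (f := fun i (_ : i ≥ k) => u i x) i hi)

theorem toFun_le_of_tendsto {u : ℕ → EuclideanSpace ℝ (Fin n) → ℝ≥0∞}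
    {v : EuclideanSpace ℝ (Fin n) → ℝ≥0∞} (hu : ∀ k, AEMeasurable (u k) volume) {M : ℝ≥0∞}
    (hM : ∀ k, E.toFun (u k) ≤ M)
    (hlim : ∀ᵐ x ∂volume, Tendsto (fun k => u k x) atTop (𝓝 (v x))) : E.toFun v ≤ M := by
  rw [E.toFun_congr_ae (aemeasurable_of_tendsto_metrizable_ae atTop hu hlim)
    (hlim.mono fun x hx => hx.liminf_eq.symm)]
  exact (E.toFun_liminf_le hu).trans
    (liminf_le_of_frequently_le' (Frequently.of_forall hM))

section Minkowski

variable {H : Type*} [MeasurableSpace H] {g : EuclideanSpace ℝ (Fin n) → H → ℝ≥0∞} {M : ℝ≥0∞}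

/-- By the strong law of large numbers the integral is a limit of averages over a random sample,
which avoids the duality with the associate space in the usual proof of Minkowski's inequality. -/
theorem toFun_lintegral_le_of_ne_top (ν : Measure H) [IsProbabilityMeasure ν]
    (hg : Measurable (Function.uncurry g)) (hfin : ∀ x, ∫⁻ h, g x h ∂ν ≠ ∞)
    (hM : ∀ᵐ h ∂ν, E.toFun (fun x => g x h) ≤ M) :
    E.toFun (fun x => ∫⁻ h, g x h ∂ν) ≤ M := by
  have hsection (h : H) : Measurable fun x => g x h := hg.comp measurable_prodMk_right
  have hlim_meas : MeasurableSet {z : EuclideanSpace ℝ (Fin n) × (ℕ → H) |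
      Tendsto (fun N : ℕ => ((N : ℝ≥0)⁻¹ : ℝ≥0) * ∑ i ∈ Finset.range N, g z.1 (z.2 i)) atTop
        (𝓝 (∫⁻ h, g z.1 h ∂ν))} := by
    refine measurableSet_tendsto_fun (fun N => ?_) (hg.lintegral_prod_right'.comp measurable_fst)
    refine (Finset.measurable_fun_sum _ fun i _ => ?_).const_mul _
    exact hg.comp (measurable_fst.prodMk ((measurable_pi_apply i).comp measurable_snd))
  have hlim := (Measure.ae_ae_comm (μ := volume) hlim_meas).1 <| Eventually.of_forall fun x =>
    ae_tendsto_ennreal_average_infinitePi ν (hg.comp measurable_prodMk_left) (hfin x)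
  have hsample : ∀ᵐ ω ∂Measure.infinitePi fun _ : ℕ => ν,
      ∀ i, E.toFun (fun x => g x (ω i)) ≤ M := ae_all_iff.2 fun i =>
    (measurePreserving_eval_infinitePi (fun _ => ν) i).quasiMeasurePreserving.ae hM
  obtain ⟨ω, hω_lim, hω⟩ := (hlim.and hsample).exists
  refine E.toFun_le_of_tendsto (fun N => ?_)
    (fun N => E.toFun_average_le N _ (fun i => (hsection (ω i)).aemeasurable) hω) hω_lim
  exact ((Finset.measurable_fun_sum _ fun i _ => hsection (ω i)).const_mul _).aemeasurable

theorem toFun_lintegral_le_of_isProbabilityMeasure (ν : Measure H) [IsProbabilityMeasure ν]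
    (hg : Measurable (Function.uncurry g)) (hM : ∀ᵐ h ∂ν, E.toFun (fun x => g x h) ≤ M) :
    E.toFun (fun x => ∫⁻ h, g x h ∂ν) ≤ M := by
  have hsection (h : H) : Measurable fun x => g x h := hg.comp measurable_prodMk_right
  have hmin (k : ℕ) : Measurable (Function.uncurry fun x h => min (g x h) k) :=
    hg.min measurable_const
  have hmin_ne_top (k : ℕ) (x) : ∫⁻ h, min (g x h) k ∂ν ≠ ∞ :=
    ne_top_of_le_ne_top (ENNReal.natCast_ne_top k)
      ((lintegral_mono fun h => min_le_right _ _).trans (by simp))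
  refine E.toFun_le_of_tendsto (u := fun k x => ∫⁻ h, min (g x h) k ∂ν)
    (fun k => (hmin k).lintegral_prod_right'.aemeasurable) (fun k => ?_)
    (Eventually.of_forall fun x => ?_)
  · refine E.toFun_lintegral_le_of_ne_top ν (hmin k) (hmin_ne_top k) (hM.mono fun h hh => ?_)
    exact (E.mono _ _ ((hsection h).min measurable_const).aemeasurable
      (hsection h).aemeasurable (Eventually.of_forall fun x => min_le_left _ _)).trans hh
  · refine lintegral_tendsto_of_tendsto_of_monotone
      (fun k => ((hmin k).comp measurable_prodMk_left).aemeasurable)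
      (Eventually.of_forall fun h k l hkl => min_le_min_left _ (by exact_mod_cast hkl))
      (Eventually.of_forall fun h => ?_)
    simpa using (tendsto_const_nhds (x := g x h)).min ENNReal.tendsto_nat_nhds_top

theorem toFun_lintegral_le (ν : Measure H) [IsFiniteMeasure ν]
    (hg : Measurable (Function.uncurry g)) (hM : ∀ᵐ h ∂ν, E.toFun (fun x => g x h) ≤ M) :
    E.toFun (fun x => ∫⁻ h, g x h ∂ν) ≤ ν univ * M := by
  rcases eq_or_ne ν 0 with rfl | hν
  · simp [E.toFun_zero]
  have hmass_ne_zero : ν univ ≠ 0 := by simpa using hν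
  let m : ℝ≥0 := (ν univ).toNNReal
  have hm : (m : ℝ≥0∞) = ν univ := ENNReal.coe_toNNReal (measure_ne_top _ _)
  let P : Measure H := (ν univ)⁻¹ • ν
  have : IsProbabilityMeasure P :=
    ⟨by simp [P, ENNReal.inv_mul_cancel hmass_ne_zero (measure_ne_top ν univ)]⟩
  have hν_eq : ν = (m : ℝ≥0∞) • P := by
    simp [P, hm, smul_smul, ENNReal.mul_inv_cancel hmass_ne_zero (measure_ne_top ν univ)]
  have hscale (x) : ∫⁻ h, g x h ∂ν = m * ∫⁻ h, g x h ∂P := by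
    conv_lhs => rw [hν_eq]
    rw [lintegral_smul_measure, smul_eq_mul]
  simp only [hscale]
  rw [E.const_mul _ _ (Measurable.lintegral_prod_right hg).aemeasurable, hm]
  gcongr
  exact E.toFun_lintegral_le_of_isProbabilityMeasure P hg (Measure.ae_smul_measure hM _)

variable {𝕜 : Type*} [RCLike 𝕜]

theorem toFun_enorm_integral_smul_le {μ : Measure H} [SFinite μ] {r : H → ℝ} (hr : Measurable r)
    {m : ℝ≥0∞} (hm : m ≠ ∞) (hrm : ∫⁻ h, ‖r h‖ₑ ∂μ ≤ m)
    {G : EuclideanSpace ℝ (Fin n) → H → 𝕜} (hG : Measurable (Function.uncurry G))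
    (hM : ∀ h, r h ≠ 0 → E.toFun (fun x => ‖G x h‖ₑ) ≤ M) :
    E.toFun (fun x => ‖∫ h, r h • G x h ∂μ‖ₑ) ≤ m * M := by
  let ν := μ.withDensity fun h => ‖r h‖ₑ
  have hν : ν univ = ∫⁻ h, ‖r h‖ₑ ∂μ := by simp [ν]
  have : IsFiniteMeasure ν := ⟨by rw [hν]; exact hrm.trans_lt hm.lt_top⟩
  have hνM : ∀ᵐ h ∂ν, E.toFun (fun x => ‖G x h‖ₑ) ≤ M :=
    (ae_withDensity_iff hr.enorm).2 (Eventually.of_forall fun h hh => hM h (by simpa using hh))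
  have hintegral : Measurable fun x => ∫ h, r h • G x h ∂μ :=
    (((hr.comp measurable_snd).smul hG).stronglyMeasurable.integral_prod_right' (ν := μ)).measurable
  have hle (x) : ‖∫ h, r h • G x h ∂μ‖ₑ ≤ ∫⁻ h, ‖G x h‖ₑ ∂ν := by
    have hsection : Measurable fun h => ‖G x h‖ₑ := (hG.comp measurable_prodMk_left).enorm
    rw [lintegral_withDensity_eq_lintegral_mul μ hr.enorm hsection]
    simpa [enorm_smul] using enorm_integral_le_lintegral_enorm (μ := μ) fun h => r h • G x h
  calc E.toFun (fun x => ‖∫ h, r h • G x h ∂μ‖ₑ)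
      ≤ E.toFun (fun x => ∫⁻ h, ‖G x h‖ₑ ∂ν) := E.mono _ _ hintegral.enorm.aemeasurable
        hG.enorm.lintegral_prod_right'.aemeasurable (Eventually.of_forall hle)
    _ ≤ ν univ * M := E.toFun_lintegral_le ν hG.enorm hνM
    _ ≤ m * M := by rw [hν]; gcongr

end Minkowski

end RIFunctionNorm

section Modulus

variable {n : ℕ} (E : RIFunctionNorm n) {𝕜 : Type*} [RCLike 𝕜]

theorem RIFunctionNorm.toFun_translate {g : EuclideanSpace ℝ (Fin n) → 𝕜}
    (hg : Measurable g) (h : EuclideanSpace ℝ (Fin n)) :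
    E.toFun (fun x => ‖g (x + h)‖ₑ) = E.toFun (fun x => ‖g x‖ₑ) := by
  refine E.rearrangement_invariant _ _ (hg.comp (measurable_add_const h)).enorm.aemeasurable
    hg.enorm.aemeasurable (by simp) (by simp) fun s => ?_
  exact (measurePreserving_add_right volume h).measure_preimage
    (measurableSet_lt measurable_const hg.enorm).nullMeasurableSet

theorem RIFunctionNorm.toFun_enorm_add_le {f g : EuclideanSpace ℝ (Fin n) → 𝕜}
    (hf : Measurable f) (hg : Measurable g) :
    E.toFun (fun x => ‖f x + g x‖ₑ) ≤ E.toFun (fun x => ‖f x‖ₑ) + E.toFun (fun x => ‖g x‖ₑ) :=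
  (E.mono _ _ (hf.add hg).enorm.aemeasurable (hf.enorm.add hg.enorm).aemeasurable
    (Eventually.of_forall fun _ => enorm_add_le _ _)).trans
    (E.add_le _ _ hf.enorm.aemeasurable hg.enorm.aemeasurable)

theorem RIFunctionNorm.add_mem_space {f g : EuclideanSpace ℝ (Fin n) →ₘ[volume] 𝕜}
    (hf : f ∈ E.space 𝕜) (hg : g ∈ E.space 𝕜) : f + g ∈ E.space 𝕜 := by
  refine lt_of_le_of_lt (le_of_eq_of_le ?_ (E.toFun_enorm_add_le f.measurable g.measurable))
    (ENNReal.add_lt_top.2 ⟨hf, hg⟩)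
  refine E.toFun_congr_ae (f + g).measurable.enorm.aemeasurable ?_
  filter_upwards [AEEqFun.coeFn_add f g] with x hx
  rw [hx, Pi.add_apply]

theorem RIFunctionNorm.neg_mem_space {f : EuclideanSpace ℝ (Fin n) →ₘ[volume] 𝕜}
    (hf : f ∈ E.space 𝕜) : -f ∈ E.space 𝕜 := by
  refine lt_of_eq_of_lt (E.toFun_congr_ae (-f).measurable.enorm.aemeasurable ?_) hf
  filter_upwards [AEEqFun.coeFn_neg f] with x hx
  rw [hx, Pi.neg_apply, enorm_neg]

theorem RIFunctionNorm.locallyIntegrable_of_mem_space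
    {f : EuclideanSpace ℝ (Fin n) →ₘ[volume] 𝕜} (hf : f ∈ E.space 𝕜) :
    LocallyIntegrable f volume := by
  refine locallyIntegrable_iff.2 fun K hK => ⟨f.aestronglyMeasurable.restrict, ?_⟩
  obtain ⟨C, hC⟩ := E.lintegral_le K hK.measurableSet hK.measure_lt_top
  exact (hC _ f.measurable.enorm.aemeasurable).trans_lt (ENNReal.mul_lt_top ENNReal.coe_lt_top hf)

variable {E}

theorem le_modulus (f : EuclideanSpace ℝ (Fin n) →ₘ[volume] 𝕜) {t : ℝ}
    {h : EuclideanSpace ℝ (Fin n)} (hh : ‖h‖ ≤ t) :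
    E.toFun (fun x => ‖f (x + h) - f x‖ₑ) ≤ modulus E f t :=
  le_iSup₂ (f := fun (h : EuclideanSpace ℝ (Fin n)) (_ : ‖h‖ ≤ t) =>
    E.toFun fun x => ‖f (x + h) - f x‖ₑ) h hh

theorem modulus_le_of_ae_eq {f : EuclideanSpace ℝ (Fin n) →ₘ[volume] 𝕜}
    {g : EuclideanSpace ℝ (Fin n) → 𝕜} (hfg : f =ᵐ[volume] g) {t : ℝ} {M : ℝ≥0∞}
    (hM : ∀ h : EuclideanSpace ℝ (Fin n), ‖h‖ ≤ t → E.toFun (fun x => ‖g (x + h) - g x‖ₑ) ≤ M) :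
    modulus E f t ≤ M := by
  refine iSup₂_le fun h hh => (le_of_eq (E.toFun_congr_ae ?_ ?_)).trans (hM h hh)
  · exact ((f.measurable.comp (measurable_add_const h)).sub f.measurable).enorm.aemeasurable
  · filter_upwards [hfg, (measurePreserving_add_right volume h).quasiMeasurePreserving.ae hfg]
      with x hx hxh
    rw [hx, hxh]

theorem modulus_mono (f : EuclideanSpace ℝ (Fin n) →ₘ[volume] 𝕜) : Monotone (modulus E f) :=
  fun _ _ hst => iSup₂_le fun _ hh => le_modulus f (hh.trans hst)

theorem modulus_add_le (f g : EuclideanSpace ℝ (Fin n) →ₘ[volume] 𝕜) (t : ℝ) :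
    modulus E (f + g) t ≤ modulus E f t + modulus E g t := by
  refine modulus_le_of_ae_eq (AEEqFun.coeFn_add f g) fun h hh => ?_
  simp only [Pi.add_apply, add_sub_add_comm]
  exact (E.toFun_enorm_add_le ((f.measurable.comp (measurable_add_const h)).sub f.measurable)
    ((g.measurable.comp (measurable_add_const h)).sub g.measurable)).trans
    (add_le_add (le_modulus f hh) (le_modulus g hh))

theorem modulus_neg_le (f : EuclideanSpace ℝ (Fin n) →ₘ[volume] 𝕜) (t : ℝ) :
    modulus E (-f) t ≤ modulus E f t := by
  refine modulus_le_of_ae_eq (AEEqFun.coeFn_neg f) fun h hh => ?_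
  simp only [Pi.neg_apply, ← neg_sub', enorm_neg]
  exact le_modulus f hh

theorem modulus_sub_le (f g : EuclideanSpace ℝ (Fin n) →ₘ[volume] 𝕜) (t : ℝ) :
    modulus E (f - g) t ≤ modulus E f t + modulus E g t := by
  rw [sub_eq_add_neg]
  exact (modulus_add_le f (-g) t).trans (by gcongr; exact modulus_neg_le g t)

theorem modulus_le_two_mul_toFun (f : EuclideanSpace ℝ (Fin n) →ₘ[volume] 𝕜) (t : ℝ) :
    modulus E f t ≤ 2 * E.toFun (fun x => ‖f x‖ₑ) := by
  refine iSup₂_le fun h _ => ?_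
  simp only [sub_eq_add_neg]
  refine (E.toFun_enorm_add_le (f.measurable.comp (measurable_add_const h))
    f.measurable.neg).trans_eq ?_
  simp only [Function.comp_apply, Pi.neg_apply, enorm_neg, E.toFun_translate f.measurable h,
    two_mul]

theorem modulus_two_mul_le (f : EuclideanSpace ℝ (Fin n) →ₘ[volume] 𝕜) (t : ℝ) :
    modulus E f (2 * t) ≤ 2 * modulus E f t := by
  refine iSup₂_le fun h hh => ?_
  set k : EuclideanSpace ℝ (Fin n) := (2⁻¹ : ℝ) • h
  have hk : ‖k‖ ≤ t := by
    rw [norm_smul, Real.norm_of_nonneg (by norm_num)]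
    linarith
  have hhk : h = k + k := by rw [← two_smul ℝ k, smul_inv_smul₀ two_ne_zero]
  have hdiff : Measurable fun x => f (x + k) - f x :=
    (f.measurable.comp (measurable_add_const k)).sub f.measurable
  calc E.toFun (fun x => ‖f (x + h) - f x‖ₑ)
      = E.toFun (fun x => ‖(f (x + k + k) - f (x + k)) + (f (x + k) - f x)‖ₑ) := by
        simp only [hhk, add_assoc, sub_add_sub_cancel]
    _ ≤ E.toFun (fun x => ‖f (x + k + k) - f (x + k)‖ₑ) + E.toFun (fun x => ‖f (x + k) - f x‖ₑ) :=
        E.toFun_enorm_add_le (hdiff.comp (measurable_add_const k)) hdiff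
    _ ≤ 2 * modulus E f t := by
        rw [E.toFun_translate hdiff k, two_mul]
        exact add_le_add (le_modulus f hk) (le_modulus f hk)

end Modulus

section Kernel

variable {n : ℕ}

theorem integrable_smul_comp_add_smul {𝕜 : Type*} [RCLike 𝕜] {f : EuclideanSpace ℝ (Fin n) → 𝕜}
    (hf : LocallyIntegrable f volume) {p : EuclideanSpace ℝ (Fin n) → ℝ} (hp : Continuous p)
    (hsupp : HasCompactSupport p) {τ : ℝ} (hτ : 0 < τ) (x : EuclideanSpace ℝ (Fin n)) :
    Integrable fun h => p h • f (x + τ • h) := by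
  have hsupp' : HasCompactSupport fun y => p (τ⁻¹ • (y - x)) :=
    hsupp.comp_homeomorph ((Homeomorph.subRight x).trans
      (Homeomorph.smulOfNeZero τ⁻¹ (inv_ne_zero hτ.ne')))
  have hint : Integrable fun y => p (τ⁻¹ • (y - x)) • f y :=
    hf.integrable_smul_left_of_hasCompactSupport (by fun_prop) hsupp'
  simpa [inv_smul_smul₀ hτ.ne'] using (hint.comp_add_left x).comp_smul hτ.ne'

theorem exists_lintegral_enorm_sub_le_of_lipschitz {p : EuclideanSpace ℝ (Fin n) → ℝ} {K : ℝ≥0}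
    (hp : LipschitzWith K p) (hsupp : ∀ h, 1 < ‖h‖ → p h = 0) :
    ∃ C : ℝ≥0, ∀ y, ‖y‖ ≤ 1 → ∫⁻ h, ‖p (h - y) - p h‖ₑ ≤ C * ‖y‖ₑ := by
  set B : Set (EuclideanSpace ℝ (Fin n)) := Metric.closedBall 0 2
  have hB : volume B ≠ ∞ := measure_closedBall_lt_top.ne
  refine ⟨K * (volume B).toNNReal, fun y hy => ?_⟩
  have hpointwise (h) : ‖p (h - y) - p h‖ₑ ≤ B.indicator (fun _ => K * ‖y‖ₑ) h := by
    by_cases hh : h ∈ B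
    · rw [indicator_of_mem hh, ← edist_eq_enorm_sub]
      refine (hp (h - y) h).trans_eq ?_
      rw [edist_eq_enorm_sub, sub_sub_cancel_left, enorm_neg]
    · have hh' : 2 < ‖h‖ := by simpa [B] using hh
      have hhy : ‖h‖ ≤ ‖h - y‖ + ‖y‖ := by simpa using norm_add_le (h - y) y
      simp [hsupp h (by linarith), hsupp (h - y) (by linarith)]
  refine (lintegral_mono hpointwise).trans_eq ?_
  rw [lintegral_indicator_const Metric.isClosed_closedBall.measurableSet, ENNReal.coe_mul,
    ENNReal.coe_toNNReal hB]
  ring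

/-- A fixed smooth bump, equal to `1` near `0` and supported in the closed unit ball; its
normalization is the kernel of the averages `mollify`. -/
noncomputable def unitBump (n : ℕ) : ContDiffBump (0 : EuclideanSpace ℝ (Fin n)) :=
  ⟨1 / 2, 1, by norm_num, by norm_num⟩

theorem unitBump_normed_eq_zero {h : EuclideanSpace ℝ (Fin n)} (hh : 1 < ‖h‖) :
    (unitBump n).normed volume h = 0 := by
  rw [← Function.notMem_support, (unitBump n).support_normed_eq, mem_ball_zero_iff, not_lt]
  exact hh.le

theorem lintegral_enorm_unitBump_normed : ∫⁻ h, ‖(unitBump n).normed volume h‖ₑ = 1 := by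
  rw [← ENNReal.ofReal_one, ← (unitBump n).integral_normed (μ := volume),
    ofReal_integral_eq_lintegral_ofReal (unitBump n).integrable_normed
      (Eventually.of_forall (unitBump n).nonneg_normed)]
  exact lintegral_congr fun h => Real.enorm_of_nonneg ((unitBump n).nonneg_normed h)

theorem exists_lintegral_enorm_unitBump_sub_le (n : ℕ) : ∃ C : ℝ≥0, ∀ y, ‖y‖ ≤ 1 →
    ∫⁻ h, ‖(unitBump n).normed volume (h - y) - (unitBump n).normed volume h‖ₑ ≤ C * ‖y‖ₑ := by
  obtain ⟨K, hK⟩ := (unitBump n).contDiff_normed (μ := volume) (n := 1)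
    |>.lipschitzWith_of_hasCompactSupport (unitBump n).hasCompactSupport_normed one_ne_zero
  exact exists_lintegral_enorm_sub_le_of_lipschitz hK fun _ => unitBump_normed_eq_zero

end Kernel

section Mollify

variable {n : ℕ} {E : RIFunctionNorm n} {𝕜 : Type*} [RCLike 𝕜]

/-- The average `x ↦ ∫ φ(h) f(x + τ h) dh` of `f` at scale `τ`, for the normalized bump `φ`; it is
the smooth part in the decomposition that estimates the `K`-functional. -/
noncomputable def mollify (τ : ℝ) (f : EuclideanSpace ℝ (Fin n) →ₘ[volume] 𝕜) :
    EuclideanSpace ℝ (Fin n) →ₘ[volume] 𝕜 :=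
  AEEqFun.mk (fun x => ∫ h, (unitBump n).normed volume h • f (x + τ • h)) <|
    StronglyMeasurable.aestronglyMeasurable <| StronglyMeasurable.integral_prod_right'
      (f := fun z : EuclideanSpace ℝ (Fin n) × EuclideanSpace ℝ (Fin n) =>
        (unitBump n).normed volume z.2 • f (z.1 + τ • z.2)) <|
      ((unitBump n).continuous_normed.measurable.comp measurable_snd).smul
        (f.measurable.comp (by fun_prop)) |>.stronglyMeasurable

theorem coeFn_mollify (τ : ℝ) (f : EuclideanSpace ℝ (Fin n) →ₘ[volume] 𝕜) :
    mollify τ f =ᵐ[volume] fun x => ∫ h, (unitBump n).normed volume h • f (x + τ • h) :=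
  AEEqFun.coeFn_mk _ _

variable {f : EuclideanSpace ℝ (Fin n) →ₘ[volume] 𝕜} {τ : ℝ}

theorem integrable_unitBump_smul (hf : f ∈ E.space 𝕜) (hτ : 0 < τ)
    (x : EuclideanSpace ℝ (Fin n)) :
    Integrable fun h => (unitBump n).normed volume h • f (x + τ • h) :=
  integrable_smul_comp_add_smul (E.locallyIntegrable_of_mem_space hf)
    (unitBump n).continuous_normed (unitBump n).hasCompactSupport_normed hτ x

theorem modulus_mollify_le (hf : f ∈ E.space 𝕜) (hτ : 0 < τ) (u : ℝ) :
    modulus E (mollify τ f) u ≤ modulus E f u := by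
  refine modulus_le_of_ae_eq (coeFn_mollify τ f) fun y hy => ?_
  have hdiff : Measurable fun x => f (x + y) - f x :=
    (f.measurable.comp (measurable_add_const y)).sub f.measurable
  have hsub (x) : (∫ h, (unitBump n).normed volume h • f (x + y + τ • h)) -
      ∫ h, (unitBump n).normed volume h • f (x + τ • h) =
      ∫ h, (unitBump n).normed volume h • (f (x + τ • h + y) - f (x + τ • h)) := by
    simp_rw [smul_sub, add_right_comm x _ y]
    exact (integral_sub (integrable_unitBump_smul hf hτ _)
      (integrable_unitBump_smul hf hτ _)).symm
  simp only [hsub]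
  refine (E.toFun_enorm_integral_smul_le (unitBump n).continuous_normed.measurable
    ENNReal.one_ne_top lintegral_enorm_unitBump_normed.le
    (G := fun x h => f (x + τ • h + y) - f (x + τ • h)) (hdiff.comp (by fun_prop))
    fun h _ => ?_).trans_eq (one_mul _)
  exact (E.toFun_translate hdiff (τ • h)).trans_le (le_modulus f hy)

theorem toFun_sub_mollify_le (hf : f ∈ E.space 𝕜) (hτ : 0 < τ) :
    E.toFun (fun x => ‖(f - mollify τ f) x‖ₑ) ≤ modulus E f τ := by
  have hsub : (fun x => ‖(f - mollify τ f) x‖ₑ) =ᵐ[volume]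
      fun x => ‖∫ h, (unitBump n).normed volume h • (f (x + τ • h) - f x)‖ₑ := by
    filter_upwards [AEEqFun.coeFn_sub f (mollify τ f), coeFn_mollify τ f] with x hx hmoll
    simp_rw [smul_sub]
    rw [hx, Pi.sub_apply, hmoll, integral_sub (integrable_unitBump_smul hf hτ x)
      ((unitBump n).integrable_normed.smul_const _), ContDiffBump.integral_normed_smul,
      enorm_sub_rev]
  rw [E.toFun_congr_ae (f - mollify τ f).measurable.enorm.aemeasurable hsub]
  refine (E.toFun_enorm_integral_smul_le (unitBump n).continuous_normed.measurable
    ENNReal.one_ne_top lintegral_enorm_unitBump_normed.le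
    (G := fun x h => f (x + τ • h) - f x) ((f.measurable.comp (by fun_prop)).sub
      (f.measurable.comp measurable_fst)) fun h hh => le_modulus f ?_).trans_eq (one_mul _)
  have hh1 : ‖h‖ ≤ 1 := not_lt.1 fun hlt => hh (unitBump_normed_eq_zero hlt)
  rw [norm_smul, Real.norm_of_nonneg hτ.le]
  exact mul_le_of_le_one_right hτ.le hh1

/-- Translating the average translates the kernel, and the difference of the two kernels has mean
zero, so `f x` may be subtracted from `f (x + τ • h)`. -/
theorem integral_unitBump_translate_sub (hf : f ∈ E.space 𝕜) (hτ : 0 < τ)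
    (x y : EuclideanSpace ℝ (Fin n)) :
    (∫ h, (unitBump n).normed volume h • f (x + y + τ • h)) -
      ∫ h, (unitBump n).normed volume h • f (x + τ • h) =
    ∫ h, ((unitBump n).normed volume (h - τ⁻¹ • y) - (unitBump n).normed volume h) •
      (f (x + τ • h) - f x) := by
  set p := (unitBump n).normed volume
  set v := τ⁻¹ • y
  have hp : Integrable p := (unitBump n).integrable_normed
  have hshift : ∫ h, p h • f (x + y + τ • h) = ∫ h, p (h - v) • f (x + τ • h) := by
    rw [← integral_sub_right_eq_self _ v]
    simp only [v, smul_sub, smul_inv_smul₀ hτ.ne', add_assoc, add_sub_cancel]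
  have hshift_int : Integrable fun h => p (h - v) • f (x + τ • h) :=
    integrable_smul_comp_add_smul (E.locallyIntegrable_of_mem_space hf)
      ((unitBump n).continuous_normed.comp (continuous_sub_right v))
      ((unitBump n).hasCompactSupport_normed.comp_homeomorph (Homeomorph.subRight v)) hτ x
  have hmean_zero : ∫ h, p (h - v) - p h = 0 := by
    rw [integral_sub (hp.comp_sub_right v) hp, integral_sub_right_eq_self, sub_self]
  have hp_int : Integrable fun h => p h • f (x + τ • h) := integrable_unitBump_smul hf hτ x
  have hdiff_int : Integrable fun h => p (h - v) - p h := (hp.comp_sub_right v).sub hp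
  have hleft_int : Integrable fun h => (p (h - v) - p h) • f (x + τ • h) := by
    simpa only [sub_smul, Pi.sub_def] using hshift_int.sub hp_int
  simp_rw [smul_sub]
  rw [integral_sub hleft_int (hdiff_int.smul_const _), integral_smul_const, hmean_zero, zero_smul,
    sub_zero, hshift, ← integral_sub hshift_int hp_int]
  simp only [sub_smul]

theorem exists_modulus_mollify_le_mul (n : ℕ) : ∃ C : ℝ≥0, ∀ (E : RIFunctionNorm n)
    (𝕜 : Type*) [RCLike 𝕜], ∀ f ∈ E.space 𝕜, ∀ τ u : ℝ, 0 < τ → u ≤ τ →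
      modulus E (mollify τ f) u ≤ C * ENNReal.ofReal (u / τ) * modulus E f τ := by
  obtain ⟨C, hC⟩ := exists_lintegral_enorm_unitBump_sub_le n
  refine ⟨C * 2, fun E 𝕜 _ f hf τ u hτ hu => modulus_le_of_ae_eq (coeFn_mollify τ f) fun y hy => ?_⟩
  have hnorm : ‖τ⁻¹ • y‖ = ‖y‖ / τ := by
    rw [norm_smul, Real.norm_of_nonneg (inv_nonneg.2 hτ.le), div_eq_inv_mul]
  have hle_one : ‖τ⁻¹ • y‖ ≤ 1 := hnorm.trans_le ((div_le_one hτ).2 (hy.trans hu))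
  have hkernel : Continuous fun h =>
      (unitBump n).normed volume (h - τ⁻¹ • y) - (unitBump n).normed volume h :=
    ((unitBump n).continuous_normed.comp (continuous_sub_right _)).sub
      (unitBump n).continuous_normed
  have hbound (h) (hh : (unitBump n).normed volume (h - τ⁻¹ • y) -
      (unitBump n).normed volume h ≠ 0) :
      E.toFun (fun x => ‖f (x + τ • h) - f x‖ₑ) ≤ modulus E f (2 * τ) := by
    refine le_modulus f ?_
    have hh2 : ‖h‖ ≤ 2 := by
      by_contra! hlt
      have htri : ‖h‖ ≤ ‖h - τ⁻¹ • y‖ + ‖τ⁻¹ • y‖ := by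
        simpa using norm_add_le (h - τ⁻¹ • y) (τ⁻¹ • y)
      exact hh (by rw [unitBump_normed_eq_zero (by linarith), unitBump_normed_eq_zero
        (by linarith), sub_zero])
    rw [norm_smul, Real.norm_of_nonneg hτ.le, mul_comm]
    gcongr
  simp only [integral_unitBump_translate_sub hf hτ]
  calc E.toFun (fun x => ‖∫ h, ((unitBump n).normed volume (h - τ⁻¹ • y) -
        (unitBump n).normed volume h) • (f (x + τ • h) - f x)‖ₑ)
      ≤ C * ‖τ⁻¹ • y‖ₑ * modulus E f (2 * τ) :=
        E.toFun_enorm_integral_smul_le hkernel.measurable (by finiteness) (hC _ hle_one)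
          ((f.measurable.comp (by fun_prop)).sub (f.measurable.comp measurable_fst)) hbound
    _ ≤ C * ENNReal.ofReal (u / τ) * (2 * modulus E f τ) := by
        rw [← ofReal_norm, hnorm]
        gcongr
        exact modulus_two_mul_le f τ
    _ = (C * 2 : ℝ≥0) * ENNReal.ofReal (u / τ) * modulus E f τ := by push_cast; ring

theorem sub_mollify_mem_space (hf : f ∈ E.space 𝕜) (hτ : 0 < τ) :
    f - mollify τ f ∈ E.space 𝕜 :=
  ((toFun_sub_mollify_le hf hτ).trans (modulus_le_two_mul_toFun f τ)).trans_lt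
    (ENNReal.mul_lt_top ENNReal.ofNat_lt_top hf)

theorem mollify_mem_space (hf : f ∈ E.space 𝕜) (hτ : 0 < τ) : mollify τ f ∈ E.space 𝕜 := by
  simpa using E.add_mem_space hf (E.neg_mem_space (sub_mollify_mem_space hf hτ))

theorem modulus_sub_mollify_le (hf : f ∈ E.space 𝕜) (hτ : 0 < τ) (u : ℝ) :
    modulus E (f - mollify τ f) u ≤ 2 * min (modulus E f u) (modulus E f τ) := by
  rw [mul_min_of_nonneg _ _ zero_le]
  refine le_min ?_ ((modulus_le_two_mul_toFun _ u).trans ?_)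
  swap
  · gcongr
    exact toFun_sub_mollify_le hf hτ
  rw [two_mul]
  exact (modulus_sub_le _ _ u).trans (by gcongr; exact modulus_mollify_le hf hτ u)

end Mollify

section SlowlyVarying

theorem EquivPos.exists_le_mul {f g : ℝ → ℝ} (h : EquivPos f g) : ∃ C : ℝ, 0 < C ∧
    ∀ s t, 0 < s → 0 < t → g s ≤ g t → f s ≤ C * f t := by
  obtain ⟨c, C, hc, hC, hfg⟩ := h
  refine ⟨C / c, by positivity, fun s t hs ht hst => ?_⟩
  calc f s ≤ C * g s := (hfg s hs).2
    _ ≤ C * g t := by gcongr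
    _ = C / c * (c * g t) := by field_simp
    _ ≤ C / c * f t := mul_le_mul_of_nonneg_left (hfg t ht).1 (by positivity)

variable {q : ℝ} {b : ℝ → ℝ}

theorem SlowlyVarying.exists_potter_bound (hb : SlowlyVarying b) {α : ℝ} (hα : 0 < α) :
    ∃ C : ℝ, 0 < C ∧ ∀ s t, 0 < s → 0 < t → b s ≤ C * max (s / t) (t / s) ^ α * b t := by
  obtain ⟨g, -, hg, hbg⟩ := hb.equiv_monotone α hα
  obtain ⟨h, -, hh, hbh⟩ := hb.equiv_antitone α hα
  obtain ⟨C, hC, hinc⟩ := hbg.exists_le_mul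
  obtain ⟨D, -, hdec⟩ := hbh.exists_le_mul
  refine ⟨max C D, by positivity, fun s t hs ht => ?_⟩
  have hbt := hb.pos t ht
  rcases le_total s t with hst | hst
  · calc b s = (s ^ α)⁻¹ * (s ^ α * b s) := by field_simp
      _ ≤ (s ^ α)⁻¹ * (C * (t ^ α * b t)) :=
          mul_le_mul_of_nonneg_left (hinc s t hs ht (hg hs ht hst)) (by positivity)
      _ = C * (t / s) ^ α * b t := by rw [Real.div_rpow ht.le hs.le]; ring
      _ ≤ max C D * max (s / t) (t / s) ^ α * b t := by
          gcongr
          exacts [le_max_left _ _, le_max_right _ _]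
  · calc b s = s ^ α * (s ^ (-α) * b s) := by rw [Real.rpow_neg hs.le]; field_simp
      _ ≤ s ^ α * (D * (t ^ (-α) * b t)) :=
          mul_le_mul_of_nonneg_left (hdec s t hs ht (hh ht hs hst)) (by positivity)
      _ = D * (s / t) ^ α * b t := by rw [Real.div_rpow hs.le ht.le, Real.rpow_neg ht.le]; ring
      _ ≤ max C D * max (s / t) (t / s) ^ α * b t := by
          gcongr
          exacts [le_max_right _ _, le_max_left _ _]

theorem rpow_le_two_rpow_abs_mul {s t : ℝ} (hs : 0 < s) (ht : 0 < t) (hst : s ≤ 2 * t)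
    (hts : t ≤ 2 * s) (α : ℝ) : s ^ α ≤ 2 ^ |α| * t ^ α := by
  rw [← div_le_iff₀ (by positivity), ← Real.div_rpow hs.le ht.le]
  rcases le_total 0 α with hα | hα
  · rw [abs_of_nonneg hα]
    exact Real.rpow_le_rpow (by positivity) ((div_le_iff₀ ht).2 hst) hα
  · rw [abs_of_nonpos hα, ← inv_div, Real.inv_rpow (by positivity),
      ← Real.rpow_neg (by positivity)]
    exact Real.rpow_le_rpow (by positivity) ((div_le_iff₀ hs).2 hts) (neg_nonneg.2 hα)

theorem SlowlyVarying.exists_rpow_mul_le (hb : SlowlyVarying b) (α : ℝ) : ∃ C : ℝ, 0 < C ∧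
    ∀ s t, 0 < s → 0 < t → s ≤ 2 * t → t ≤ 2 * s → s ^ α * b s ≤ C * (t ^ α * b t) := by
  obtain ⟨C, hC, hpotter⟩ := hb.exists_potter_bound one_pos
  refine ⟨2 ^ |α| * (C * 2), by positivity, fun s t hs ht hst hts => ?_⟩
  have hbs := hb.pos s hs
  have hbt := hb.pos t ht
  have hmax : max (s / t) (t / s) ≤ 2 := max_le ((div_le_iff₀ ht).2 hst) ((div_le_iff₀ hs).2 hts)
  calc s ^ α * b s ≤ 2 ^ |α| * t ^ α * (C * max (s / t) (t / s) * b t) := by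
        gcongr
        · exact rpow_le_two_rpow_abs_mul hs ht hst hts α
        · simpa only [Real.rpow_one] using hpotter s t hs ht
    _ ≤ 2 ^ |α| * t ^ α * (C * 2 * b t) := by gcongr
    _ = 2 ^ |α| * (C * 2) * (t ^ α * b t) := by ring

theorem SlowlyVarying.exists_le_of_le_two_mul (hb : SlowlyVarying b) : ∃ C : ℝ, 0 < C ∧
    ∀ s t, 0 < s → 0 < t → s ≤ 2 * t → t ≤ 2 * s → b s ≤ C * b t := by
  simpa only [Real.rpow_zero, one_mul] using hb.exists_rpow_mul_le 0

end SlowlyVarying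

section LogWeight

/-- The density of the measure `w(u)^q du/u`, in terms of which all the quasi-norms
`‖u^(-1/q) w(u) g(u)‖_q` are `q`-th roots of integrals of `g^q`. -/
noncomputable def logWeight (q : ℝ) (w : ℝ → ℝ) (u : ℝ) : ℝ≥0∞ := ENNReal.ofReal (w u ^ q / u)

variable {q : ℝ} {w : ℝ → ℝ} {s t : ℝ}

theorem ofReal_rpow_neg_mul_rpow {u x : ℝ} (hq : 0 < q) (hu : 0 < u) (hx : 0 ≤ x) :
    ENNReal.ofReal (u ^ (-(1 / q)) * x) ^ q = ENNReal.ofReal (x ^ q / u) := by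
  rw [ENNReal.ofReal_rpow_of_nonneg (by positivity) hq.le, Real.mul_rpow (by positivity) hx,
    ← Real.rpow_mul hu.le, neg_mul, one_div_mul_cancel hq.ne', Real.rpow_neg_one, div_eq_inv_mul]

theorem eLpNorm'_rpow_neg_mul_rpow (hq : 0 < q) (hs : 0 ≤ s) (hw : ∀ u, s < u → 0 ≤ w u)
    (g : ℝ → ℝ≥0∞) :
    eLpNorm' (fun u => ENNReal.ofReal (u ^ (-(1 / q)) * w u) * g u) q
        (volume.restrict (Ioi s)) ^ q =
      ∫⁻ u in Ioi s, logWeight q w u * g u ^ q := by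
  rw [eLpNorm'_eq_lintegral_enorm, ← ENNReal.rpow_mul, one_div_mul_cancel hq.ne', ENNReal.rpow_one]
  refine setLIntegral_congr_fun measurableSet_Ioi fun u hu => ?_
  rw [enorm_eq_self, ENNReal.mul_rpow_of_nonneg _ _ hq.le,
    ofReal_rpow_neg_mul_rpow hq (hs.trans_lt hu) (hw u hu), logWeight]

theorem aemeasurable_logWeight (hw : AEMeasurable w (volume.restrict (Ioi 0))) :
    AEMeasurable (logWeight q w) (volume.restrict (Ioi 0)) :=
  ((hw.pow_const q).div aemeasurable_id).ennreal_ofReal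

theorem setLIntegral_logWeight_mul_le (hq : 0 < q) (hs : 0 < s) {M : ℝ} {N : ℝ≥0∞} {g : ℝ → ℝ≥0∞}
    (hM : ∀ u ∈ Ioc s t, 0 ≤ w u ∧ w u ≤ M) (hN : ∀ u ∈ Ioc s t, g u ≤ N) :
    ∫⁻ u in Ioc s t, logWeight q w u * g u ^ q ≤
      ENNReal.ofReal ((t - s) / s) * (ENNReal.ofReal M * N) ^ q := by
  rcases le_or_gt t s with hts | hst
  · simp [Ioc_eq_empty hts.not_gt]
  have hM0 : 0 ≤ M := (hM t ⟨hst, le_rfl⟩).1.trans (hM t ⟨hst, le_rfl⟩).2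
  have hle : ∀ u ∈ Ioc s t, logWeight q w u * g u ^ q ≤ ENNReal.ofReal (M ^ q / s) * N ^ q := by
    intro u hu
    have hsu := hu.1.le
    have hpow := Real.rpow_le_rpow (hM u hu).1 (hM u hu).2 hq.le
    have hNu := hN u hu
    unfold logWeight
    gcongr
  refine (setLIntegral_mono' measurableSet_Ioc hle).trans_eq ?_
  rw [setLIntegral_const, Real.volume_Ioc, ENNReal.mul_rpow_of_nonneg _ _ hq.le,
    ENNReal.ofReal_rpow_of_nonneg hM0 hq.le, mul_right_comm, ← ENNReal.ofReal_mul (by positivity),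
    ← mul_assoc, ← ENNReal.ofReal_mul (div_nonneg (sub_nonneg.2 hst.le) hs.le)]
  ring_nf

theorem rpow_le_two_mul_setLIntegral_logWeight (hq : 0 < q) (hs : 0 < s) {m : ℝ} (hm : 0 ≤ m)
    {N : ℝ≥0∞} {g : ℝ → ℝ≥0∞} (hw : ∀ u ∈ Ioc s (2 * s), m ≤ w u)
    (hN : ∀ u ∈ Ioc s (2 * s), N ≤ g u) :
    (ENNReal.ofReal m * N) ^ q ≤ 2 * ∫⁻ u in Ioc s (2 * s), logWeight q w u * g u ^ q := by
  have hle : ∀ u ∈ Ioc s (2 * s),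
      ENNReal.ofReal (m ^ q / (2 * s)) * N ^ q ≤ logWeight q w u * g u ^ q := by
    intro u hu
    have hu0 := hs.trans hu.1
    have hpow := Real.rpow_le_rpow hm (hw u hu) hq.le
    have hNu := hN u hu
    have hpow0 := (Real.rpow_nonneg hm q).trans hpow
    have hu2 := hu.2
    unfold logWeight
    gcongr
  calc (ENNReal.ofReal m * N) ^ q
      = 2 * ∫⁻ _ in Ioc s (2 * s), ENNReal.ofReal (m ^ q / (2 * s)) * N ^ q := by
        rw [setLIntegral_const, Real.volume_Ioc, ENNReal.mul_rpow_of_nonneg _ _ hq.le,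
          ENNReal.ofReal_rpow_of_nonneg hm hq.le, mul_right_comm, ← mul_assoc,
          ← ENNReal.ofReal_mul (by positivity), ← ENNReal.ofReal_ofNat 2,
          ← ENNReal.ofReal_mul (by positivity)]
        congr 2
        field_simp
        ring
    _ ≤ 2 * ∫⁻ u in Ioc s (2 * s), logWeight q w u * g u ^ q :=
        mul_le_mul_right (setLIntegral_mono' measurableSet_Ioc hle) _

theorem lintegral_Ioc_zero_rpow_div {a : ℝ} (ha : 0 < a) (ht : 0 < t) :
    ∫⁻ u in Ioc 0 t, ENNReal.ofReal ((u / t) ^ a / u) = ENNReal.ofReal (1 / a) := by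
  have hint : IntegrableOn (fun u : ℝ => u ^ (a - 1)) (Ioc 0 t) :=
    (intervalIntegrable_iff_integrableOn_Ioc_of_le ht.le).1
      (intervalIntegral.intervalIntegrable_rpow' (by linarith))
  have hpow : ∀ u ∈ Ioc 0 t, (u / t) ^ a / u = (t ^ a)⁻¹ * u ^ (a - 1) := fun u hu => by
    rw [Real.div_rpow hu.1.le ht.le, Real.rpow_sub_one hu.1.ne']
    ring
  rw [setLIntegral_congr_fun measurableSet_Ioc fun u hu => congrArg ENNReal.ofReal (hpow u hu),
    ← ofReal_integral_eq_lintegral_ofReal (hint.const_mul _)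
      ((ae_restrict_iff' measurableSet_Ioc).2 <| Eventually.of_forall fun u hu =>
        mul_nonneg (by positivity) (Real.rpow_nonneg hu.1.le _)),
    integral_const_mul, ← intervalIntegral.integral_of_le ht.le,
    integral_rpow (Or.inl (by linarith)), sub_add_cancel, Real.zero_rpow ha.ne', sub_zero]
  congr 1
  field_simp

end LogWeight

section TailNorm

variable {q : ℝ} {b : ℝ → ℝ} {s t : ℝ}

theorem tailNorm_nonneg : 0 ≤ tailNorm q b t := ENNReal.toReal_nonneg

theorem SlowlyVarying.tail_rpow (hq : 0 < q) (hb : SlowlyVarying b) (ht : 0 ≤ t) :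
    eLpNorm' (fun u : ℝ => u ^ (-(1 / q)) * b u) q (volume.restrict (Ioi t)) ^ q =
      ∫⁻ u in Ioi t, logWeight q b u := by
  have hnonneg : ∀ u ∈ Ioi t, 0 ≤ b u := fun u hu => (hb.pos u (ht.trans_lt hu)).le
  rw [eLpNorm'_eq_lintegral_enorm, ← ENNReal.rpow_mul, one_div_mul_cancel hq.ne', ENNReal.rpow_one]
  refine setLIntegral_congr_fun measurableSet_Ioi fun u hu => ?_
  have hu0 : 0 < u := ht.trans_lt hu
  rw [Real.enorm_of_nonneg (mul_nonneg (by positivity) (hnonneg u hu)),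
    ofReal_rpow_neg_mul_rpow hq hu0 (hnonneg u hu), logWeight]

theorem SlowlyVarying.lintegral_Ioc_logWeight_lt_top (hq : 0 < q) (hb : SlowlyVarying b)
    (hs : 0 < s) : ∫⁻ u in Ioc s t, logWeight q b u < ∞ := by
  obtain ⟨C, hC, hpotter⟩ := hb.exists_potter_bound one_pos
  have hle : ∀ u ∈ Ioc s t, 0 ≤ b u ∧ b u ≤ C * (t / s) * b t := by
    intro u hu
    have hu0 := hs.trans hu.1
    have ht0 := hu0.trans_le hu.2
    have hbt := hb.pos t ht0
    refine ⟨(hb.pos u hu0).le, (hpotter u t hu0 ht0).trans ?_⟩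
    rw [Real.rpow_one]
    have hsu := hu.1.le
    gcongr
    refine max_le (((div_le_one ht0).2 hu.2).trans ?_) (by gcongr)
    exact (one_le_div hs).2 (hsu.trans hu.2)
  have hbound := setLIntegral_logWeight_mul_le hq hs hle (g := 1) (N := 1) fun _ _ => le_rfl
  simp only [Pi.one_apply, ENNReal.one_rpow, mul_one] at hbound
  exact hbound.trans_lt (by finiteness)

theorem SlowlyVaryingZero.lintegral_Ioi_logWeight_lt_top (hq : 0 < q)
    (hb : SlowlyVaryingZero q b) (ht : 0 < t) : ∫⁻ u in Ioi t, logWeight q b u < ∞ := by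
  have htail : ∫⁻ u in Ioi 1, logWeight q b u < ∞ := by
    rw [← hb.tail_rpow hq zero_le_one]
    exact ENNReal.rpow_lt_top_of_nonneg hq.le hb.tail_lt_top.ne
  have hsub : Ioi t ⊆ Ioc t 1 ∪ Ioi 1 := fun u hu =>
    (le_or_gt u 1).imp (fun h => ⟨hu, h⟩) id
  exact (lintegral_mono_set hsub).trans_lt <| (lintegral_union_le _ _ _).trans_lt <|
    ENNReal.add_lt_top.2 ⟨hb.lintegral_Ioc_logWeight_lt_top hq ht, htail⟩

theorem SlowlyVaryingZero.lintegral_Ioi_logWeight (hq : 0 < q) (hb : SlowlyVaryingZero q b)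
    (ht : 0 < t) :
    ∫⁻ u in Ioi t, logWeight q b u = ENNReal.ofReal (tailNorm q b t) ^ q := by
  have hfin := hb.lintegral_Ioi_logWeight_lt_top hq ht
  rw [← hb.tail_rpow hq ht.le, ENNReal.rpow_lt_top_iff_of_pos hq] at hfin
  rw [← hb.tail_rpow hq ht.le, tailNorm, ENNReal.ofReal_toReal hfin.ne]

theorem SlowlyVaryingZero.tailNorm_antitoneOn (hq : 0 < q) (hb : SlowlyVaryingZero q b) :
    AntitoneOn (tailNorm q b) (Ioi 0) := by
  intro s hs t ht hst
  have hle : ∫⁻ u in Ioi t, logWeight q b u ≤ ∫⁻ u in Ioi s, logWeight q b u :=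
    lintegral_mono_set (Ioi_subset_Ioi hst)
  rwa [hb.lintegral_Ioi_logWeight hq hs, hb.lintegral_Ioi_logWeight hq ht,
    ENNReal.rpow_le_rpow_iff hq, ENNReal.ofReal_le_ofReal_iff tailNorm_nonneg] at hle

theorem SlowlyVaryingZero.exists_le_tailNorm (hq : 0 < q) (hb : SlowlyVaryingZero q b) :
    ∃ C : ℝ, 0 < C ∧ ∀ t, 0 < t → b t ≤ C * tailNorm q b t := by
  obtain ⟨C, hC, hdouble⟩ := hb.exists_le_of_le_two_mul
  refine ⟨C * 2 ^ (1 / q), by positivity, fun t ht => ?_⟩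
  have hbt := hb.pos t ht
  have hlow : ∀ u ∈ Ioc t (2 * t), b t / C ≤ b u := fun u hu =>
    (div_le_iff₀' hC).2 (hdouble t u ht (ht.trans hu.1) (by linarith [hu.1]) hu.2)
  have hmass := rpow_le_two_mul_setLIntegral_logWeight hq ht (by positivity) hlow
    (g := 1) (N := 1) fun _ _ => le_rfl
  simp only [Pi.one_apply, ENNReal.one_rpow, mul_one] at hmass
  have hle : ENNReal.ofReal (b t / C) ^ q ≤ 2 * ENNReal.ofReal (tailNorm q b t) ^ q := by
    rw [← hb.lintegral_Ioi_logWeight hq ht]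
    refine hmass.trans ?_
    gcongr
    exact Ioc_subset_Ioi_self
  rw [show (2 : ℝ≥0∞) = ENNReal.ofReal (2 ^ (1 / q)) ^ q by
      rw [ENNReal.ofReal_rpow_of_nonneg (by positivity) hq.le, ← Real.rpow_mul zero_le_two,
        one_div_mul_cancel hq.ne', Real.rpow_one, ENNReal.ofReal_ofNat],
    ← ENNReal.mul_rpow_of_nonneg _ _ hq.le, ENNReal.rpow_le_rpow_iff hq,
    ← ENNReal.ofReal_mul (by positivity),
    ENNReal.ofReal_le_ofReal_iff (mul_nonneg (by positivity) tailNorm_nonneg),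
    div_le_iff₀' hC, ← mul_assoc] at hle
  exact hle

theorem SlowlyVaryingZero.tailNorm_pos (hq : 0 < q) (hb : SlowlyVaryingZero q b) (ht : 0 < t) :
    0 < tailNorm q b t := by
  obtain ⟨C, hC, hle⟩ := hb.exists_le_tailNorm hq
  exact pos_of_mul_pos_right ((hb.pos t ht).trans_le (hle t ht)) hC.le

theorem SlowlyVaryingZero.lintegral_Ioc_logWeight (hq : 0 < q) (hb : SlowlyVaryingZero q b)
    (hs : 0 < s) (hst : s ≤ t) :
    ∫⁻ u in Ioc s t, logWeight q b u =
      ENNReal.ofReal (tailNorm q b s) ^ q - ENNReal.ofReal (tailNorm q b t) ^ q := by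
  rw [← hb.lintegral_Ioi_logWeight hq hs, ← hb.lintegral_Ioi_logWeight hq (hs.trans_le hst),
    ← Ioc_union_Ioi_eq_Ioi hst, lintegral_union measurableSet_Ioi (Ioc_disjoint_Ioi le_rfl),
    ENNReal.add_sub_cancel_right
      (hb.lintegral_Ioi_logWeight_lt_top hq (hs.trans_le hst)).ne]

theorem SlowlyVaryingZero.setIntegral_Ioi_rpow_div (hq : 0 < q) (hb : SlowlyVaryingZero q b)
    (ht : 0 < t) : ∫ u in Ioi t, b u ^ q / u = tailNorm q b t ^ q := by
  have hmeas : AEStronglyMeasurable (fun u => b u ^ q / u) (volume.restrict (Ioi t)) :=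
    (((hb.aemeasurable.pow_const q).div aemeasurable_id).aestronglyMeasurable).mono_measure
      (Measure.restrict_mono (Ioi_subset_Ioi ht.le) le_rfl)
  have hnonneg : 0 ≤ᵐ[volume.restrict (Ioi t)] fun u => b u ^ q / u :=
    (ae_restrict_iff' measurableSet_Ioi).2 <| Eventually.of_forall fun u hu =>
      div_nonneg (Real.rpow_nonneg (hb.pos u (ht.trans hu)).le q) (ht.trans hu).le
  rw [integral_eq_lintegral_of_nonneg_ae hnonneg hmeas]
  change (∫⁻ u in Ioi t, logWeight q b u).toReal = _
  rw [hb.lintegral_Ioi_logWeight hq ht, ← ENNReal.toReal_rpow,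
    ENNReal.toReal_ofReal tailNorm_nonneg]

theorem SlowlyVaryingZero.integrableOn_Ioi_rpow_div (hq : 0 < q) (hb : SlowlyVaryingZero q b)
    (ht : 0 < t) : IntegrableOn (fun u => b u ^ q / u) (Ioi t) :=
  not_imp_comm.1 integral_undef <| by
    rw [hb.setIntegral_Ioi_rpow_div hq ht]
    exact (Real.rpow_pos_of_pos (hb.tailNorm_pos hq ht) q).ne'

theorem SlowlyVaryingZero.continuousOn_tailNorm (hq : 0 < q) (hb : SlowlyVaryingZero q b) :
    ContinuousOn (tailNorm q b) (Ioi 0) := by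
  have hpow : ContinuousOn (fun t => ∫ u in Ioi t, b u ^ q / u) (Ioi 0) := fun t ht =>
    ((hb.integrableOn_Ioi_rpow_div hq (half_pos ht)).continuousOn_Ici_primitive_Ioi.continuousAt
      (Ici_mem_nhds (half_lt_self ht))).continuousWithinAt
  refine (hpow.rpow_const fun _ _ => Or.inr (one_div_pos.2 hq).le).congr fun t ht => ?_
  dsimp only
  rw [hb.setIntegral_Ioi_rpow_div hq ht, ← Real.rpow_mul tailNorm_nonneg,
    mul_one_div_cancel hq.ne', Real.rpow_one]

theorem SlowlyVarying.exists_logWeight_mul_div_rpow_le (hq : 0 < q) (hb : SlowlyVarying b) :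
    ∃ C : ℝ≥0, ∀ t u, 0 < u → u ≤ t → logWeight q b u * ENNReal.ofReal (u / t) ^ q ≤
      C * ENNReal.ofReal (b t) ^ q * ENNReal.ofReal ((u / t) ^ (q / 2) / u) := by
  obtain ⟨C, hC, hpotter⟩ := hb.exists_potter_bound one_half_pos
  refine ⟨(C ^ q).toNNReal, fun t u hu hut => ?_⟩
  have ht := hu.trans_le hut
  have hbt := hb.pos t ht
  have hbu := hb.pos u hu
  have hmax : max (u / t) (t / u) = t / u :=
    max_eq_right (((div_le_one ht).2 hut).trans ((one_le_div hu).2 hut))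
  have hle : b u * (u / t) ≤ C * b t * (u / t) ^ (1 / 2 : ℝ) := by
    calc b u * (u / t) ≤ C * (t / u) ^ (1 / 2 : ℝ) * b t * (u / t) := by
          gcongr
          simpa only [hmax] using hpotter u t hu ht
      _ = C * b t * ((u / t) ^ (-(1 / 2) : ℝ) * (u / t) ^ (1 : ℝ)) := by
          rw [← inv_div u t, Real.inv_rpow (by positivity), ← Real.rpow_neg (by positivity),
            Real.rpow_one]
          ring
      _ = C * b t * (u / t) ^ (1 / 2 : ℝ) := by
          rw [← Real.rpow_add (by positivity)]
          norm_num
  rw [ENNReal.ofNNReal_toNNReal, logWeight, ENNReal.ofReal_rpow_of_nonneg (by positivity) hq.le,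
    ENNReal.ofReal_rpow_of_nonneg hbt.le hq.le, ← ENNReal.ofReal_mul (by positivity),
    ← ENNReal.ofReal_mul (by positivity), ← ENNReal.ofReal_mul (by positivity)]
  refine ENNReal.ofReal_le_ofReal ?_
  calc b u ^ q / u * (u / t) ^ q = (b u * (u / t)) ^ q / u := by
        rw [Real.mul_rpow hbu.le (by positivity)]
        ring
    _ ≤ (C * b t * (u / t) ^ (1 / 2 : ℝ)) ^ q / u := by gcongr
    _ = C ^ q * b t ^ q * ((u / t) ^ (q / 2) / u) := by
        rw [Real.mul_rpow (by positivity) (by positivity), Real.mul_rpow hC.le hbt.le,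
          ← Real.rpow_mul (by positivity), one_div_mul_eq_div]
        ring

theorem SlowlyVaryingZero.exists_lintegral_Ioc_zero_le (hq : 0 < q) (hb : SlowlyVaryingZero q b) :
    ∃ C : ℝ≥0, ∀ t, 0 < t → ∫⁻ u in Ioc 0 t, logWeight q b u * ENNReal.ofReal (u / t) ^ q ≤
      C * ENNReal.ofReal (tailNorm q b t) ^ q := by
  obtain ⟨C, hpt⟩ := hb.exists_logWeight_mul_div_rpow_le hq
  obtain ⟨D, hD, hle⟩ := hb.exists_le_tailNorm hq
  refine ⟨C * D.toNNReal ^ q * (1 / (q / 2)).toNNReal, fun t ht => ?_⟩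
  calc ∫⁻ u in Ioc 0 t, logWeight q b u * ENNReal.ofReal (u / t) ^ q
      ≤ ∫⁻ u in Ioc 0 t,
          C * ENNReal.ofReal (b t) ^ q * ENNReal.ofReal ((u / t) ^ (q / 2) / u) :=
        setLIntegral_mono' measurableSet_Ioc fun u hu => hpt t u hu.1 hu.2
    _ = C * ENNReal.ofReal (b t) ^ q * ENNReal.ofReal (1 / (q / 2)) := by
        rw [lintegral_const_mul' _ _ (by finiteness), lintegral_Ioc_zero_rpow_div (half_pos hq) ht]
    _ ≤ C * ENNReal.ofReal (D * tailNorm q b t) ^ q * ENNReal.ofReal (1 / (q / 2)) := by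
        gcongr
        exact hle t ht
    _ = _ := by
        rw [ENNReal.ofReal_mul hD.le, ENNReal.mul_rpow_of_nonneg _ _ hq.le, ENNReal.coe_mul,
          ENNReal.coe_mul, ENNReal.coe_rpow_of_nonneg _ hq.le]
        simp only [ENNReal.ofNNReal_toNNReal]
        ring

end TailNorm

section Sequences

theorem lintegral_Ioi_zero_eq_tsum {a : ℤ → ℝ} (ha : Monotone a) (hpos : ∀ k, 0 < a k)
    (hcover : ∀ x, 0 < x → ∃ k, x ∈ Ioc (a k) (a (k + 1))) (g : ℝ → ℝ≥0∞) :
    ∫⁻ u in Ioi 0, g u = ∑' k : ℤ, ∫⁻ u in Ioc (a k) (a (k + 1)), g u := by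
  have hunion : Ioi (0 : ℝ) = ⋃ k : ℤ, Ioc (a k) (a (k + 1)) := by
    ext x
    simp only [mem_Ioi, mem_iUnion]
    exact ⟨hcover x, fun ⟨k, hk⟩ => (hpos k).trans hk.1⟩
  rw [hunion, lintegral_iUnion fun k => measurableSet_Ioc]
  exact ha.pairwise_disjoint_on_Ioc_succ

theorem lintegral_Ioc_zero_le_tsum {a : ℤ → ℝ} (ha : Monotone a)
    (hcover : ∀ x, 0 < x → ∃ k, x ∈ Ioc (a k) (a (k + 1))) (g : ℝ → ℝ≥0∞) (k : ℤ) :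
    ∫⁻ u in Ioc 0 (a k), g u ≤ ∑' i : ℕ, ∫⁻ u in Ioc (a (k - i - 1)) (a (k - i)), g u := by
  refine (lintegral_mono_set fun x hx => ?_).trans (lintegral_iUnion_le _ _)
  obtain ⟨j, hj⟩ := hcover x hx.1
  have hjk : j < k := ha.reflect_lt (hj.1.trans_le hx.2)
  have hindex : k - ((k - 1 - j).toNat : ℤ) = j + 1 := by omega
  refine mem_iUnion.2 ⟨(k - 1 - j).toNat, ?_⟩
  rwa [hindex, add_sub_cancel_right]

theorem lintegral_Ioi_le_tsum {a : ℤ → ℝ} (ha : Monotone a) (hpos : ∀ k, 0 < a k)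
    (hcover : ∀ x, 0 < x → ∃ k, x ∈ Ioc (a k) (a (k + 1))) (g : ℝ → ℝ≥0∞) (k : ℤ) :
    ∫⁻ u in Ioi (a k), g u ≤ ∑' i : ℕ, ∫⁻ u in Ioc (a (k + i)) (a (k + i + 1)), g u := by
  refine (lintegral_mono_set fun x hx => ?_).trans (lintegral_iUnion_le _ _)
  obtain ⟨j, hj⟩ := hcover x ((hpos k).trans hx)
  have hkj : k < j + 1 := ha.reflect_lt (hx.trans_le hj.2)
  have hindex : k + ((j - k).toNat : ℤ) = j := by omega
  refine mem_iUnion.2 ⟨(j - k).toNat, ?_⟩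
  rwa [hindex]

theorem lintegral_Ioi_zero_eq_tsum_dyadic (g : ℝ → ℝ≥0∞) :
    ∫⁻ u in Ioi 0, g u = ∑' k : ℤ, ∫⁻ u in Ioc ((2 : ℝ) ^ k) (2 * 2 ^ k), g u := by
  have hdouble : ∀ k : ℤ, (2 : ℝ) ^ (k + 1) = 2 * 2 ^ k := fun k => by
    rw [zpow_add_one₀ two_ne_zero, mul_comm]
  simp only [← hdouble]
  exact lintegral_Ioi_zero_eq_tsum (zpow_right_mono₀ one_le_two) (fun k => by positivity)
    (fun x hx => exists_mem_Ioc_zpow hx one_lt_two) g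

theorem add_rpow_le_two_rpow_mul (x y : ℝ≥0∞) {q : ℝ} (hq : 0 ≤ q) :
    (x + y) ^ q ≤ 2 ^ q * (x ^ q + y ^ q) := by
  wlog hxy : x ≤ y generalizing x y
  · rw [add_comm x, add_comm (x ^ q)]
    exact this y x (le_of_not_ge hxy)
  calc (x + y) ^ q ≤ (2 * y) ^ q := by rw [two_mul]; gcongr
    _ = 2 ^ q * y ^ q := ENNReal.mul_rpow_of_nonneg _ _ hq
    _ ≤ 2 ^ q * (x ^ q + y ^ q) := by gcongr; exact le_add_self

theorem tsum_mul_rpow_rpow_le {ι : Type*} {r q : ℝ} (hr : 0 < r) (hq : 0 < q) (g D : ι → ℝ≥0∞) :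
    (∑' i, (g i * D i) ^ r) ^ (q / r) ≤ (∑' i, g i ^ r) ^ (q / r) * ∑' i, D i ^ q := by
  set S := ∑' i, D i ^ q
  have hterm : ∀ i, (g i * D i) ^ r ≤ g i ^ r * S ^ (r / q) := by
    intro i
    rw [ENNReal.mul_rpow_of_nonneg _ _ hr.le]
    gcongr
    calc D i ^ r = (D i ^ q) ^ (r / q) := by rw [← ENNReal.rpow_mul, mul_div_cancel₀ _ hq.ne']
      _ ≤ S ^ (r / q) := by
          gcongr
          exact ENNReal.le_tsum (f := fun i => D i ^ q) i
  calc (∑' i, (g i * D i) ^ r) ^ (q / r) ≤ (∑' i, g i ^ r * S ^ (r / q)) ^ (q / r) := by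
        gcongr with i
        exact hterm i
    _ = (∑' i, g i ^ r) ^ (q / r) * S := by
        rw [ENNReal.tsum_mul_right, ENNReal.mul_rpow_of_nonneg _ _ (by positivity),
          ← ENNReal.rpow_mul, div_mul_div_cancel₀ hq.ne', div_self hr.ne', ENNReal.rpow_one]

theorem tsum_pow_rpow_ne_top {ν : ℝ≥0∞} (hν : ν < 1) {s : ℝ} (hs : 0 < s) :
    ∑' i : ℕ, (ν ^ i) ^ s ≠ ∞ := by
  have hcomm : ∀ i : ℕ, (ν ^ i) ^ s = (ν ^ s) ^ i := fun i => by
    rw [← ENNReal.rpow_natCast, ← ENNReal.rpow_mul, mul_comm, ENNReal.rpow_mul,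
      ENNReal.rpow_natCast]
  simp_rw [hcomm]
  rw [ENNReal.tsum_geometric]
  exact ENNReal.inv_ne_top.2 (tsub_pos_of_lt (ENNReal.rpow_lt_one hν hs)).ne'

/- One factor `√μ ^ i` of the kernel makes the inner `ℓ^r` sum comparable to an `ℓ^q` sum, the other
one is summed after exchanging the order of summation; this covers `q < r` and `r ≤ q` at once. -/
theorem exists_tsum_geometric_rpow_le {μ : ℝ≥0∞} (hμ : μ < 1) {r q : ℝ} (hr : 0 < r)
    (hq : 0 < q) : ∃ C : ℝ≥0, ∀ (e : ℕ → ℤ) (D : ℤ → ℝ≥0∞),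
      ∑' k : ℤ, (∑' i : ℕ, (μ ^ i * D (k + e i)) ^ r) ^ (q / r) ≤ C * ∑' k : ℤ, D k ^ q := by
  set ν := μ ^ (1 / 2 : ℝ)
  have hν : ν < 1 := ENNReal.rpow_lt_one hμ one_half_pos
  have hμν : μ = ν * ν := by
    rw [← ENNReal.rpow_add_of_nonneg _ _ (by norm_num) (by norm_num), add_halves, ENNReal.rpow_one]
  have hfin : (∑' i : ℕ, (ν ^ i) ^ r) ^ (q / r) * ∑' i : ℕ, (ν ^ i) ^ q ≠ ∞ := ENNReal.mul_ne_top
    (ENNReal.rpow_ne_top_of_nonneg (by positivity) (tsum_pow_rpow_ne_top hν hr))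
    (tsum_pow_rpow_ne_top hν hq)
  lift (∑' i : ℕ, (ν ^ i) ^ r) ^ (q / r) * ∑' i : ℕ, (ν ^ i) ^ q to ℝ≥0 using hfin with C hC
  refine ⟨C, fun e D => ?_⟩
  calc ∑' k : ℤ, (∑' i : ℕ, (μ ^ i * D (k + e i)) ^ r) ^ (q / r)
      ≤ ∑' k : ℤ, (∑' i : ℕ, (ν ^ i) ^ r) ^ (q / r) * ∑' i : ℕ, (ν ^ i * D (k + e i)) ^ q := by
        gcongr with k
        simp only [hμν, mul_pow, mul_assoc]
        exact tsum_mul_rpow_rpow_le hr hq _ _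
    _ = (∑' i : ℕ, (ν ^ i) ^ r) ^ (q / r) * ∑' (i : ℕ) (k : ℤ), (ν ^ i) ^ q * D (k + e i) ^ q := by
        rw [ENNReal.tsum_mul_left, ENNReal.tsum_comm]
        simp_rw [ENNReal.mul_rpow_of_nonneg _ _ hq.le]
    _ = (∑' i : ℕ, (ν ^ i) ^ r) ^ (q / r) * ∑' i : ℕ, (ν ^ i) ^ q * ∑' k : ℤ, D k ^ q := by
        congr! 3 with i
        rw [ENNReal.tsum_mul_left]
        congr 1
        exact (Equiv.addRight (e i)).tsum_eq fun k => D k ^ q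
    _ = C * ∑' k : ℤ, D k ^ q := by rw [ENNReal.tsum_mul_right, ← mul_assoc, hC]

theorem exists_tsum_mul_tsum_rpow_le {μ : ℝ≥0∞} (hμ : μ < 1) {r q : ℝ} (hr : 0 < r) (hq : 0 < q)
    (c c₀ : ℝ≥0) : ∃ C : ℝ≥0, ∀ (e : ℕ → ℤ) (X Y : ℤ → ℝ≥0∞),
      (∀ k i, X k ≤ c * μ ^ i * X (k + e i)) →
      ∑' k : ℤ, (X k * (c₀ * ∑' i : ℕ, Y (k + e i) ^ r) ^ (1 / r)) ^ q ≤
        C * ∑' k : ℤ, (X k * Y k) ^ q := by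
  obtain ⟨C, hC⟩ := exists_tsum_geometric_rpow_le hμ hr hq
  refine ⟨(c₀ * c ^ r) ^ (q / r) * C, fun e X Y hX => ?_⟩
  have hmove : ∀ k, (X k * (c₀ * ∑' i : ℕ, Y (k + e i) ^ r) ^ (1 / r)) ^ q =
      (c₀ * ∑' i : ℕ, (X k * Y (k + e i)) ^ r) ^ (q / r) := by
    intro k
    simp only [ENNReal.mul_rpow_of_nonneg _ _ hr.le]
    rw [ENNReal.tsum_mul_left, mul_left_comm, ENNReal.mul_rpow_of_nonneg (X k ^ r) _
      (by positivity), ENNReal.mul_rpow_of_nonneg _ _ hq.le, ← ENNReal.rpow_mul,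
      ← ENNReal.rpow_mul, mul_div_cancel₀ _ hr.ne', one_div_mul_eq_div]
  have hterm : ∀ k i, (X k * Y (k + e i)) ^ r ≤
      c ^ r * (μ ^ i * (X (k + e i) * Y (k + e i))) ^ r := by
    intro k i
    rw [← ENNReal.mul_rpow_of_nonneg _ _ hr.le]
    refine ENNReal.rpow_le_rpow ?_ hr.le
    calc X k * Y (k + e i) ≤ c * μ ^ i * X (k + e i) * Y (k + e i) :=
          mul_le_mul_left (hX k i) _
      _ = c * (μ ^ i * (X (k + e i) * Y (k + e i))) := by ring
  calc ∑' k : ℤ, (X k * (c₀ * ∑' i : ℕ, Y (k + e i) ^ r) ^ (1 / r)) ^ q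
      ≤ ∑' k : ℤ, (c₀ * ∑' i : ℕ, c ^ r * (μ ^ i * (X (k + e i) * Y (k + e i))) ^ r) ^
          (q / r) := by
        simp only [hmove]
        gcongr with k i
        exact hterm k i
    _ = (c₀ * c ^ r) ^ (q / r) *
          ∑' k : ℤ, (∑' i : ℕ, (μ ^ i * (X (k + e i) * Y (k + e i))) ^ r) ^ (q / r) := by
        simp only [ENNReal.tsum_mul_left, ← mul_assoc (c₀ : ℝ≥0∞),
          ENNReal.mul_rpow_of_nonneg (c₀ * c ^ r : ℝ≥0∞) _ (div_pos hq hr).le]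
    _ ≤ (c₀ * c ^ r) ^ (q / r) * (C * ∑' k : ℤ, (X k * Y k) ^ q) := by
        gcongr
        exact hC e fun k => X k * Y k
    _ = _ := by
        rw [ENNReal.coe_mul, ENNReal.coe_rpow_of_nonneg _ (by positivity), ENNReal.coe_mul,
          ENNReal.coe_rpow_of_nonneg _ hr.le, mul_assoc]

end Sequences

theorem two_zpow_rpow_mul_max_rpow {β : ℝ} {j : ℤ} (hj : 0 ≤ β * j) (k : ℤ) :
    ((2 : ℝ) ^ k) ^ β * max ((2 : ℝ) ^ k / 2 ^ (k + j)) (2 ^ (k + j) / 2 ^ k) ^ (|β| / 2) =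
      (2 ^ (-(|β| / 2))) ^ j.natAbs * ((2 : ℝ) ^ (k + j)) ^ β := by
  have hmax : max ((2 : ℝ) ^ k / 2 ^ (k + j)) (2 ^ (k + j) / 2 ^ k) = 2 ^ |j| := by
    rw [← zpow_sub₀ two_ne_zero, ← zpow_sub₀ two_ne_zero,
      ← (zpow_right_mono₀ (one_le_two (α := ℝ))).map_max, abs, max_comm]
    congr 2 <;> ring
  have habs : |β| * |(j : ℝ)| = β * j := by rw [← abs_mul, abs_of_nonneg hj]
  rw [hmax, ← Real.rpow_natCast, ← Real.rpow_mul zero_le_two, ← Real.rpow_intCast,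
    ← Real.rpow_intCast, ← Real.rpow_intCast, ← Real.rpow_mul zero_le_two,
    ← Real.rpow_mul zero_le_two, ← Real.rpow_mul zero_le_two, ← Real.rpow_add two_pos,
    ← Real.rpow_add two_pos, Nat.cast_natAbs]
  congr 1
  push_cast
  linear_combination habs

theorem SlowlyVarying.exists_dyadic_le {b : ℝ → ℝ} (hb : SlowlyVarying b) {β : ℝ} (hβ : β ≠ 0) :
    ∃ (c : ℝ≥0) (μ : ℝ≥0∞), μ < 1 ∧ ∀ k j : ℤ, 0 ≤ β * j →
      ENNReal.ofReal (((2 : ℝ) ^ k) ^ β * b (2 ^ k)) ≤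
        c * μ ^ j.natAbs * ENNReal.ofReal (((2 : ℝ) ^ (k + j)) ^ β * b (2 ^ (k + j))) := by
  obtain ⟨C, hC, hpotter⟩ := hb.exists_potter_bound (half_pos (abs_pos.2 hβ))
  refine ⟨C.toNNReal, ENNReal.ofReal (2 ^ (-(|β| / 2))), ?_, fun k j hj => ?_⟩
  · rw [ENNReal.ofReal_lt_one]
    exact Real.rpow_lt_one_of_one_lt_of_neg one_lt_two (by have := abs_pos.2 hβ; linarith)
  rw [ENNReal.ofNNReal_toNNReal, ← ENNReal.ofReal_pow (by positivity),
    ← ENNReal.ofReal_mul (by positivity), ← ENNReal.ofReal_mul (by positivity)]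
  refine ENNReal.ofReal_le_ofReal ?_
  calc ((2 : ℝ) ^ k) ^ β * b (2 ^ k)
      ≤ ((2 : ℝ) ^ k) ^ β * (C * max ((2 : ℝ) ^ k / 2 ^ (k + j)) (2 ^ (k + j) / 2 ^ k) ^ (|β| / 2) *
          b (2 ^ (k + j))) :=
        mul_le_mul_of_nonneg_left (hpotter _ _ (by positivity) (by positivity)) (by positivity)
    _ = C * (((2 : ℝ) ^ k) ^ β *
          max ((2 : ℝ) ^ k / 2 ^ (k + j)) (2 ^ (k + j) / 2 ^ k) ^ (|β| / 2)) *
          b (2 ^ (k + j)) := by ring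
    _ = _ := by
        rw [two_zpow_rpow_mul_max_rpow hj]
        ring

section Scale

variable {q₀ q₁ : ℝ} {b₀ b₁ : ℝ → ℝ} {t : ℝ}

theorem rho_mul_tailNorm (hq₁ : 0 < q₁) (hb₁ : SlowlyVaryingZero q₁ b₁) (ht : 0 < t) :
    rho q₀ q₁ b₀ b₁ t * tailNorm q₁ b₁ t = tailNorm q₀ b₀ t :=
  div_mul_cancel₀ _ (hb₁.tailNorm_pos hq₁ ht).ne'

theorem rho_pos (hq₀ : 0 < q₀) (hq₁ : 0 < q₁) (hb₀ : SlowlyVaryingZero q₀ b₀)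
    (hb₁ : SlowlyVaryingZero q₁ b₁) (ht : 0 < t) : 0 < rho q₀ q₁ b₀ b₁ t :=
  div_pos (hb₀.tailNorm_pos hq₀ ht) (hb₁.tailNorm_pos hq₁ ht)

theorem rhoEps_eq (hq₀ : 0 < q₀) (hq₁ : 0 < q₁) (hb₀ : SlowlyVaryingZero q₀ b₀)
    (hb₁ : SlowlyVaryingZero q₁ b₁) (ε : ℝ) (ht : 0 < t) :
    rhoEps ε q₀ q₁ b₀ b₁ t = rho q₀ q₁ b₀ b₁ t ^ (1 + ε) * tailNorm q₁ b₁ t ^ ε := by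
  have hT := hb₁.tailNorm_pos hq₁ ht
  rw [rhoEps, ← rho_mul_tailNorm hq₁ hb₁ ht, Real.mul_rpow (rho_pos hq₀ hq₁ hb₀ hb₁ ht).le hT.le,
    Real.rpow_add hT, Real.rpow_one]
  field_simp

/- Since `ρ_ε = ρ^(1+ε) T^ε` with `T = tailNorm q₁ b₁`, almost monotonicity of `ρ_ε` says that `T`
cannot drop by more than a constant factor while `ρ` doubles. -/
theorem RhoCondition.exists_tailNorm_le (hq₀ : 0 < q₀) (hq₁ : 0 < q₁)
    (hb₀ : SlowlyVaryingZero q₀ b₀) (hb₁ : SlowlyVaryingZero q₁ b₁)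
    (hcond : RhoCondition q₀ q₁ b₀ b₁) : ∃ L : ℝ, ∀ s t : ℝ, 0 < s → s ≤ t →
      rho q₀ q₁ b₀ b₁ t = 2 * rho q₀ q₁ b₀ b₁ s → tailNorm q₁ b₁ s ≤ L * tailNorm q₁ b₁ t := by
  obtain ⟨ε, hε, g, hg, hequiv⟩ := hcond
  obtain ⟨C, hC, hle⟩ := hequiv.exists_le_mul
  refine ⟨(C * 2 ^ (1 + ε)) ^ (1 / ε), fun s t hs hst hρ => ?_⟩
  have ht := hs.trans_le hst
  have hTs := hb₁.tailNorm_pos hq₁ hs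
  have hTt := hb₁.tailNorm_pos hq₁ ht
  have hρs := rho_pos hq₀ hq₁ hb₀ hb₁ hs
  have hpow : tailNorm q₁ b₁ s ^ ε ≤ C * 2 ^ (1 + ε) * tailNorm q₁ b₁ t ^ ε := by
    have hmono := hle s t hs ht (hg hs ht hst)
    rw [rhoEps_eq hq₀ hq₁ hb₀ hb₁ ε hs, rhoEps_eq hq₀ hq₁ hb₀ hb₁ ε ht, hρ,
      Real.mul_rpow zero_le_two hρs.le] at hmono
    refine le_of_mul_le_mul_left (hmono.trans_eq ?_) (Real.rpow_pos_of_pos hρs (1 + ε))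
    ring
  refine (Real.rpow_le_rpow_iff hTs.le (by positivity) hε).1 (hpow.trans_eq ?_)
  rw [Real.mul_rpow (by positivity) hTt.le, ← Real.rpow_mul (by positivity),
    one_div_mul_cancel hε.ne', Real.rpow_one]

theorem exists_rho_eq (hq₀ : 0 < q₀) (hq₁ : 0 < q₁) (hb₀ : SlowlyVaryingZero q₀ b₀)
    (hb₁ : SlowlyVaryingZero q₁ b₁) (hzero : Tendsto (rho q₀ q₁ b₀ b₁) (𝓝[>] 0) (𝓝 0))
    (htop : Tendsto (rho q₀ q₁ b₀ b₁) atTop atTop) {y : ℝ} (hy : 0 < y) :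
    ∃ t, 0 < t ∧ rho q₀ q₁ b₀ b₁ t = y := by
  have hcont : ContinuousOn (rho q₀ q₁ b₀ b₁) (Ioi 0) :=
    (hb₀.continuousOn_tailNorm hq₀).div (hb₁.continuousOn_tailNorm hq₁)
      fun t ht => (hb₁.tailNorm_pos hq₁ ht).ne'
  obtain ⟨a, hρa, ha⟩ := ((hzero.eventually (gt_mem_nhds hy)).and self_mem_nhdsWithin).exists
  obtain ⟨c, hρc, hc⟩ := ((htop.eventually_gt_atTop y).and (eventually_gt_atTop (0 : ℝ))).exists
  exact isPreconnected_Ioi.intermediate_value ha hc hcont ⟨hρa.le, hρc.le⟩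

theorem exists_mem_Ioc_of_rho_eq {τ : ℤ → ℝ} (hq₀ : 0 < q₀) (hq₁ : 0 < q₁)
    (hb₀ : SlowlyVaryingZero q₀ b₀) (hb₁ : SlowlyVaryingZero q₁ b₁)
    (hmono : MonotoneOn (rho q₀ q₁ b₀ b₁) (Ioi 0)) (hτ : ∀ k, 0 < τ k)
    (hρ : ∀ k, rho q₀ q₁ b₀ b₁ (τ k) = 2 ^ k) {x : ℝ} (hx : 0 < x) :
    ∃ k, x ∈ Ioc (τ k) (τ (k + 1)) := by
  obtain ⟨k, hlow, hupp⟩ := exists_mem_Ioc_zpow (rho_pos hq₀ hq₁ hb₀ hb₁ hx) one_lt_two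
  rcases le_or_gt x (τ (k + 1)) with hle | hgt
  · exact ⟨k, hmono.reflect_lt (hτ k) hx (by rwa [hρ]), hle⟩
  · refine ⟨k + 1, hgt, (hmono.reflect_lt hx (hτ _) (hupp.trans_lt ?_)).le⟩
    rw [hρ]
    exact zpow_lt_zpow_right₀ one_lt_two (lt_add_one _)

/-- A sequence of points at which `ρ` takes the values `2 ^ k`, and between which the tail norm of
`b₁` decreases geometrically, with `ratio` bounding the quotient of consecutive tail norms. It
discretizes all the integrals over `(0, ∞)`. -/
structure DyadicScale (q₀ q₁ : ℝ) (b₀ b₁ : ℝ → ℝ) where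
  t : ℤ → ℝ
  ratio : ℝ
  one_le_ratio : 1 ≤ ratio
  pos : ∀ k, 0 < t k
  strictMono : StrictMono t
  rho_eq : ∀ k, rho q₀ q₁ b₀ b₁ (t k) = 2 ^ k
  cover : ∀ x, 0 < x → ∃ k, x ∈ Ioc (t k) (t (k + 1))
  two_mul_tailNorm_le : ∀ k, 2 * tailNorm q₁ b₁ (t (k + 1)) ≤ tailNorm q₁ b₁ (t k)
  tailNorm_le_ratio_mul : ∀ k, tailNorm q₁ b₁ (t k) ≤ ratio * tailNorm q₁ b₁ (t (k + 1))

theorem nonempty_dyadicScale (hq₀ : 0 < q₀) (hq₁ : 0 < q₁) (hb₀ : SlowlyVaryingZero q₀ b₀)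
    (hb₁ : SlowlyVaryingZero q₁ b₁) (hcond : RhoCondition q₀ q₁ b₀ b₁)
    (hmono : MonotoneOn (rho q₀ q₁ b₀ b₁) (Ioi 0))
    (hzero : Tendsto (rho q₀ q₁ b₀ b₁) (𝓝[>] 0) (𝓝 0))
    (htop : Tendsto (rho q₀ q₁ b₀ b₁) atTop atTop) : Nonempty (DyadicScale q₀ q₁ b₀ b₁) := by
  choose τ hτ hρ using fun k : ℤ => exists_rho_eq hq₀ hq₁ hb₀ hb₁ hzero htop
    (zpow_pos (zero_lt_two' ℝ) k)
  obtain ⟨L, hL⟩ := hcond.exists_tailNorm_le hq₀ hq₁ hb₀ hb₁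
  have hdouble : ∀ k, rho q₀ q₁ b₀ b₁ (τ (k + 1)) = 2 * rho q₀ q₁ b₀ b₁ (τ k) := fun k => by
    rw [hρ, hρ, zpow_add_one₀ two_ne_zero, mul_comm]
  have hstep : ∀ k, τ k < τ (k + 1) := fun k => by
    refine hmono.reflect_lt (hτ k) (hτ (k + 1)) ?_
    rw [hdouble]
    linarith [rho_pos hq₀ hq₁ hb₀ hb₁ (hτ k)]
  refine ⟨⟨τ, max 1 L, le_max_left _ _, hτ, strictMono_int_of_lt_succ hstep, hρ,
    fun x hx => exists_mem_Ioc_of_rho_eq hq₀ hq₁ hb₀ hb₁ hmono hτ hρ hx, fun k => ?_,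
    fun k => (hL _ _ (hτ k) (hstep k).le (hdouble k)).trans ?_⟩⟩
  · have hanti := hb₀.tailNorm_antitoneOn hq₀ (hτ k) (hτ (k + 1)) (hstep k).le
    rw [← rho_mul_tailNorm hq₁ hb₁ (hτ k), ← rho_mul_tailNorm hq₁ hb₁ (hτ (k + 1)), hdouble,
      mul_comm 2, mul_assoc] at hanti
    exact le_of_mul_le_mul_left hanti (rho_pos hq₀ hq₁ hb₀ hb₁ (hτ k))
  · exact mul_le_mul_of_nonneg_right (le_max_right _ _) tailNorm_nonneg

namespace DyadicScale

variable (S : DyadicScale q₀ q₁ b₀ b₁)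

theorem tailNorm_zero_eq (hq₁ : 0 < q₁) (hb₁ : SlowlyVaryingZero q₁ b₁) (k : ℤ) :
    tailNorm q₀ b₀ (S.t k) = 2 ^ k * tailNorm q₁ b₁ (S.t k) := by
  rw [← rho_mul_tailNorm hq₁ hb₁ (S.pos k), S.rho_eq]

theorem tailNorm_zero_le_ratio_mul (hq₁ : 0 < q₁) (hb₁ : SlowlyVaryingZero q₁ b₁) (k : ℤ) :
    tailNorm q₀ b₀ (S.t k) ≤ S.ratio * tailNorm q₀ b₀ (S.t (k + 1)) := by
  have hT := tailNorm_nonneg (q := q₁) (b := b₁) (t := S.t (k + 1))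
  have hratio := S.one_le_ratio
  rw [S.tailNorm_zero_eq hq₁ hb₁, S.tailNorm_zero_eq hq₁ hb₁]
  calc 2 ^ k * tailNorm q₁ b₁ (S.t k) ≤ 2 ^ k * (S.ratio * tailNorm q₁ b₁ (S.t (k + 1))) := by
        gcongr
        exact S.tailNorm_le_ratio_mul k
    _ ≤ 2 ^ (k + 1) * (S.ratio * tailNorm q₁ b₁ (S.t (k + 1))) := by
        gcongr
        · exact one_le_two
        · exact Int.le_add_one le_rfl
    _ = S.ratio * (2 ^ (k + 1) * tailNorm q₁ b₁ (S.t (k + 1))) := by ring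

theorem rho_mem (hmono : MonotoneOn (rho q₀ q₁ b₀ b₁) (Ioi 0)) {k : ℤ} {u : ℝ}
    (hu : u ∈ Ioc (S.t k) (S.t (k + 1))) : rho q₀ q₁ b₀ b₁ u ∈ Icc (2 ^ k) (2 * 2 ^ k) := by
  have hu0 := (S.pos k).trans hu.1
  have hdouble : (2 : ℝ) * 2 ^ k = 2 ^ (k + 1) := by rw [zpow_add_one₀ two_ne_zero, mul_comm]
  rw [hdouble, ← S.rho_eq, ← S.rho_eq]
  exact ⟨hmono (S.pos k) hu0 hu.1.le, hmono hu0 (S.pos _) hu.2⟩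

end DyadicScale

end Scale

section TailWeighted

variable {q q₀ q₁ : ℝ} {b b₀ b₁ : ℝ → ℝ} {ω : ℝ → ℝ≥0∞} {s t : ℝ}

/-- The function `ω` multiplied by the tail norm of the weight `b`. For `ω` the modulus of
continuity of `f`, this is the quantity that is comparable, up to Hardy averages, with the
`K`-functional of `f`. -/
noncomputable def tailWeighted (q : ℝ) (b : ℝ → ℝ) (ω : ℝ → ℝ≥0∞) (t : ℝ) : ℝ≥0∞ :=
  ENNReal.ofReal (tailNorm q b t) * ω t

theorem SlowlyVaryingZero.lintegral_Ioi_mul_const (hq : 0 < q) (hb : SlowlyVaryingZero q b)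
    (ht : 0 < t) : ∫⁻ u in Ioi t, logWeight q b u * ω t ^ q = tailWeighted q b ω t ^ q := by
  rw [lintegral_mul_const'' _ ((aemeasurable_logWeight hb.aemeasurable).mono_set
    (Ioi_subset_Ioi ht.le)), hb.lintegral_Ioi_logWeight hq ht, tailWeighted,
    ENNReal.mul_rpow_of_nonneg _ _ hq.le]

theorem SlowlyVaryingZero.tailWeighted_rpow_le (hq : 0 < q) (hb : SlowlyVaryingZero q b)
    (hω : Monotone ω) (ht : 0 < t) :
    tailWeighted q b ω t ^ q ≤ ∫⁻ u in Ioi 0, logWeight q b u * ω u ^ q := by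
  rw [← hb.lintegral_Ioi_mul_const hq ht]
  refine (setLIntegral_mono' measurableSet_Ioi fun u hu => ?_).trans
    (lintegral_mono_set (Ioi_subset_Ioi ht.le))
  gcongr
  exact hω (mem_Ioi.1 hu).le

theorem SlowlyVaryingZero.lintegral_Ioc_mul_le (hq : 0 < q) (hb : SlowlyVaryingZero q b)
    (hω : Monotone ω) (hs : 0 < s) : ∫⁻ u in Ioc s t, logWeight q b u * ω u ^ q ≤
      (ENNReal.ofReal (tailNorm q b s) * ω t) ^ q := by
  rw [← tailWeighted.eq_def q b (fun _ => ω t) s, ← hb.lintegral_Ioi_mul_const hq hs]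
  refine (setLIntegral_mono' measurableSet_Ioc fun u hu => ?_).trans
    (lintegral_mono_set (Ioc_subset_Ioi_self : Ioc s t ⊆ Ioi s))
  gcongr
  exact hω hu.2

theorem SlowlyVaryingZero.lintegral_min_le (hq : 0 < q) (hb : SlowlyVaryingZero q b)
    (ω : ℝ → ℝ≥0∞) (ht : 0 < t) : ∫⁻ u in Ioi 0, logWeight q b u * min (ω u) (ω t) ^ q ≤
      (∫⁻ u in Ioc 0 t, logWeight q b u * ω u ^ q) + tailWeighted q b ω t ^ q := by
  rw [← Ioc_union_Ioi_eq_Ioi ht.le, ← hb.lintegral_Ioi_mul_const hq ht]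
  refine (lintegral_union_le _ _ _).trans
    (add_le_add (lintegral_mono fun u => ?_) (lintegral_mono fun u => ?_)) <;>
  · dsimp only
    gcongr
    simp

theorem SlowlyVaryingZero.exists_lintegral_le_of_le_div (hq : 0 < q)
    (hb : SlowlyVaryingZero q b) (c : ℝ≥0) : ∃ C : ℝ≥0, ∀ (ω ω' : ℝ → ℝ≥0∞) (t : ℝ), 0 < t →
      (∀ u, ω' u ≤ ω u) → (∀ u ≤ t, ω' u ≤ c * ENNReal.ofReal (u / t) * ω t) →
      ∫⁻ u in Ioi 0, logWeight q b u * ω' u ^ q ≤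
        C * (tailWeighted q b ω t ^ q + ∫⁻ u in Ioi t, logWeight q b u * ω u ^ q) := by
  obtain ⟨D, hD⟩ := hb.exists_lintegral_Ioc_zero_le hq
  refine ⟨c ^ q * D + 1, fun ω ω' t ht hle hdiv => ?_⟩
  have hsmall : ∫⁻ u in Ioc 0 t, logWeight q b u * ω' u ^ q ≤
      (c ^ q * D : ℝ≥0) * tailWeighted q b ω t ^ q := by
    calc ∫⁻ u in Ioc 0 t, logWeight q b u * ω' u ^ q
        ≤ ∫⁻ u in Ioc 0 t, logWeight q b u * ENNReal.ofReal (u / t) ^ q * (c * ω t) ^ q := by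
          refine setLIntegral_mono' measurableSet_Ioc fun u hu => ?_
          rw [mul_assoc, ← ENNReal.mul_rpow_of_nonneg _ _ hq.le, mul_left_comm, ← mul_assoc]
          gcongr
          exact hdiv u hu.2
      _ = (∫⁻ u in Ioc 0 t, logWeight q b u * ENNReal.ofReal (u / t) ^ q) * (c * ω t) ^ q := by
          refine lintegral_mul_const'' _ (((aemeasurable_logWeight hb.aemeasurable).mono_set
            Ioc_subset_Ioi_self).mul ?_)
          fun_prop
      _ ≤ D * ENNReal.ofReal (tailNorm q b t) ^ q * (c * ω t) ^ q := by
          gcongr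
          exact hD t ht
      _ = (c ^ q * D : ℝ≥0) * tailWeighted q b ω t ^ q := by
          rw [tailWeighted, ENNReal.mul_rpow_of_nonneg _ _ hq.le,
            ENNReal.mul_rpow_of_nonneg _ _ hq.le, ENNReal.coe_mul,
            ENNReal.coe_rpow_of_nonneg _ hq.le]
          ring
  have hlarge : ∫⁻ u in Ioi t, logWeight q b u * ω' u ^ q ≤
      ∫⁻ u in Ioi t, logWeight q b u * ω u ^ q := by
    refine lintegral_mono fun u => ?_
    dsimp only
    gcongr
    exact hle u
  rw [← Ioc_union_Ioi_eq_Ioi ht.le]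
  refine (lintegral_union_le _ _ _).trans ?_
  rw [mul_add]
  refine add_le_add (hsmall.trans ?_) (hlarge.trans (le_mul_of_one_le_left' ?_))
  · gcongr
    exact le_self_add
  · exact_mod_cast le_add_self

namespace DyadicScale

variable (S : DyadicScale q₀ q₁ b₀ b₁)

theorem lintegral_Ioc_zero_le (hq₀ : 0 < q₀) (hq₁ : 0 < q₁) (hb₀ : SlowlyVaryingZero q₀ b₀)
    (hb₁ : SlowlyVaryingZero q₁ b₁) (hω : Monotone ω) (k : ℤ) :
    ∫⁻ u in Ioc 0 (S.t k), logWeight q₀ b₀ u * ω u ^ q₀ ≤ ENNReal.ofReal S.ratio ^ q₀ *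
      ∑' i : ℕ, tailWeighted q₀ b₀ ω (S.t (k + -(i : ℤ))) ^ q₀ := by
  rw [← ENNReal.tsum_mul_left]
  refine (lintegral_Ioc_zero_le_tsum S.strictMono.monotone S.cover _ k).trans
    (ENNReal.tsum_le_tsum fun i => (hb₀.lintegral_Ioc_mul_le hq₀ hω (S.pos _)).trans ?_)
  rw [← ENNReal.mul_rpow_of_nonneg _ _ hq₀.le, ← sub_eq_add_neg, tailWeighted, ← mul_assoc,
    ← ENNReal.ofReal_mul (zero_le_one.trans S.one_le_ratio)]
  have hstep := S.tailNorm_zero_le_ratio_mul hq₁ hb₁ (k - i - 1)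
  rw [sub_add_cancel] at hstep
  gcongr

theorem lintegral_Ioi_le (hq₁ : 0 < q₁) (hb₁ : SlowlyVaryingZero q₁ b₁) (hω : Monotone ω)
    (k : ℤ) : ∫⁻ u in Ioi (S.t k), logWeight q₁ b₁ u * ω u ^ q₁ ≤ ENNReal.ofReal S.ratio ^ q₁ *
      ∑' i : ℕ, tailWeighted q₁ b₁ ω (S.t (k + i)) ^ q₁ := by
  calc ∫⁻ u in Ioi (S.t k), logWeight q₁ b₁ u * ω u ^ q₁
      ≤ ∑' i : ℕ, ENNReal.ofReal S.ratio ^ q₁ *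
          tailWeighted q₁ b₁ ω (S.t (k + (i + 1 : ℕ))) ^ q₁ := by
        refine (lintegral_Ioi_le_tsum S.strictMono.monotone S.pos S.cover _ k).trans
          (ENNReal.tsum_le_tsum fun i => (hb₁.lintegral_Ioc_mul_le hq₁ hω (S.pos _)).trans ?_)
        rw [← ENNReal.mul_rpow_of_nonneg _ _ hq₁.le, tailWeighted, ← mul_assoc,
          ← ENNReal.ofReal_mul (zero_le_one.trans S.one_le_ratio), Nat.cast_add_one, ← add_assoc]
        gcongr
        exact S.tailNorm_le_ratio_mul _
    _ ≤ ENNReal.ofReal S.ratio ^ q₁ * ∑' i : ℕ, tailWeighted q₁ b₁ ω (S.t (k + i)) ^ q₁ := by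
        rw [ENNReal.tsum_mul_left]
        exact mul_le_mul_right (ENNReal.tsum_comp_le_tsum_of_injective (add_left_injective 1)
          fun i : ℕ => tailWeighted q₁ b₁ ω (S.t (k + i)) ^ q₁) _

end DyadicScale

end TailWeighted

section KFunctional

variable {V : Type*} [AddCommGroup V] {A₀ A₁ : Set V} {N₀ N₁ : V → ℝ≥0∞} {f f₀ f₁ : V}

theorem kFunctional_mono (A₀ A₁ : Set V) (N₀ N₁ : V → ℝ≥0∞) (f : V) :
    Monotone fun t => kFunctional A₀ A₁ N₀ N₁ t f := by
  intro s t hst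
  refine iInf₂_mono fun f₀ _ => iInf₂_mono fun f₁ _ => iInf_mono fun _ => ?_
  gcongr

theorem kFunctional_le_of_lt_top_imp_mem (h₀ : N₀ f₀ < ∞ → f₀ ∈ A₀) (h₁ : N₁ f₁ < ∞ → f₁ ∈ A₁)
    (hf : f = f₀ + f₁) {t : ℝ} (ht : 0 < t) :
    kFunctional A₀ A₁ N₀ N₁ t f ≤ N₀ f₀ + ENNReal.ofReal t * N₁ f₁ := by
  rcases eq_or_ne (N₀ f₀) ∞ with htop₀ | hfin₀
  · simp [htop₀]
  rcases eq_or_ne (N₁ f₁) ∞ with htop₁ | hfin₁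
  · simp [htop₁, ENNReal.mul_top (ENNReal.ofReal_pos.2 ht).ne']
  exact iInf₂_le_of_le f₀ (h₀ hfin₀.lt_top)
    (iInf₂_le_of_le f₁ (h₁ hfin₁.lt_top) (iInf_le_of_le hf le_rfl))

end KFunctional

section Besov

variable {n : ℕ} {𝕜 : Type*} [RCLike 𝕜] (E : RIFunctionNorm n) {q q₀ q₁ : ℝ} {b b₀ b₁ : ℝ → ℝ}
  {t : ℝ}

theorem besovNorm_rpow (hq : 0 < q) (hb : ∀ u, 0 < u → 0 ≤ b u)
    (f : EuclideanSpace ℝ (Fin n) →ₘ[volume] 𝕜) :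
    besovNorm E q b f ^ q = ∫⁻ u in Ioi 0, logWeight q b u * modulus E f u ^ q :=
  eLpNorm'_rpow_neg_mul_rpow hq le_rfl hb _

theorem tailWeighted_modulus_le_besovNorm (hq : 0 < q) (hb : SlowlyVaryingZero q b)
    (f : EuclideanSpace ℝ (Fin n) →ₘ[volume] 𝕜) (ht : 0 < t) :
    tailWeighted q b (modulus E f) t ≤ besovNorm E q b f := by
  rw [← ENNReal.rpow_le_rpow_iff hq, besovNorm_rpow E hq fun u hu => (hb.pos u hu).le]
  exact hb.tailWeighted_rpow_le hq (modulus_mono f) ht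

theorem tailWeighted_modulus_le_kFunctional (hq₀ : 0 < q₀) (hq₁ : 0 < q₁)
    (hb₀ : SlowlyVaryingZero q₀ b₀) (hb₁ : SlowlyVaryingZero q₁ b₁)
    (f : EuclideanSpace ℝ (Fin n) →ₘ[volume] 𝕜) (ht : 0 < t) :
    tailWeighted q₀ b₀ (modulus E f) t ≤
      kFunctional (besovSpace E 𝕜 q₀ b₀) (besovSpace E 𝕜 q₁ b₁) (besovNorm E q₀ b₀)
        (besovNorm E q₁ b₁) (rho q₀ q₁ b₀ b₁ t) f := by
  refine le_iInf₂ fun f₀ _ => le_iInf₂ fun f₁ _ => le_iInf fun hf => ?_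
  have hweight : ENNReal.ofReal (tailNorm q₀ b₀ t) =
      ENNReal.ofReal (rho q₀ q₁ b₀ b₁ t) * ENNReal.ofReal (tailNorm q₁ b₁ t) := by
    rw [← rho_mul_tailNorm hq₁ hb₁ ht, ENNReal.ofReal_mul (rho_pos hq₀ hq₁ hb₀ hb₁ ht).le]
  calc tailWeighted q₀ b₀ (modulus E f) t
      ≤ ENNReal.ofReal (tailNorm q₀ b₀ t) * (modulus E f₀ t + modulus E f₁ t) := by
        rw [hf]
        exact mul_le_mul_right (modulus_add_le f₀ f₁ t) _
    _ = tailWeighted q₀ b₀ (modulus E f₀) t +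
          ENNReal.ofReal (rho q₀ q₁ b₀ b₁ t) * tailWeighted q₁ b₁ (modulus E f₁) t := by
        rw [mul_add, tailWeighted, tailWeighted, ← mul_assoc, ← hweight]
    _ ≤ besovNorm E q₀ b₀ f₀ + ENNReal.ofReal (rho q₀ q₁ b₀ b₁ t) * besovNorm E q₁ b₁ f₁ := by
        gcongr
        · exact tailWeighted_modulus_le_besovNorm E hq₀ hb₀ f₀ ht
        · exact tailWeighted_modulus_le_besovNorm E hq₁ hb₁ f₁ ht

theorem besovNorm_sub_mollify_rpow_le (hq : 0 < q) (hb : SlowlyVaryingZero q b)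
    {f : EuclideanSpace ℝ (Fin n) →ₘ[volume] 𝕜} (hf : f ∈ E.space 𝕜) (ht : 0 < t) :
    besovNorm E q b (f - mollify t f) ^ q ≤
      2 ^ q * ((∫⁻ u in Ioc 0 t, logWeight q b u * modulus E f u ^ q) +
        tailWeighted q b (modulus E f) t ^ q) := by
  rw [besovNorm_rpow E hq fun u hu => (hb.pos u hu).le]
  calc ∫⁻ u in Ioi 0, logWeight q b u * modulus E (f - mollify t f) u ^ q
      ≤ ∫⁻ u in Ioi 0, 2 ^ q * (logWeight q b u * min (modulus E f u) (modulus E f t) ^ q) := by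
        refine lintegral_mono fun u => ?_
        rw [mul_left_comm, ← ENNReal.mul_rpow_of_nonneg _ _ hq.le]
        gcongr
        exact modulus_sub_mollify_le hf ht u
    _ = 2 ^ q * ∫⁻ u in Ioi 0, logWeight q b u * min (modulus E f u) (modulus E f t) ^ q :=
        lintegral_const_mul' _ _ (by finiteness)
    _ ≤ _ := mul_le_mul_right (hb.lintegral_min_le hq _ ht) _

theorem exists_besovNorm_mollify_rpow_le (n : ℕ) (hq : 0 < q) (hb : SlowlyVaryingZero q b) :
    ∃ C : ℝ≥0, ∀ (E : RIFunctionNorm n) (𝕜 : Type*) [RCLike 𝕜], ∀ f ∈ E.space 𝕜, ∀ t, 0 < t →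
      besovNorm E q b (mollify t f) ^ q ≤ C * (tailWeighted q b (modulus E f) t ^ q +
        ∫⁻ u in Ioi t, logWeight q b u * modulus E f u ^ q) := by
  obtain ⟨c, hc⟩ := exists_modulus_mollify_le_mul n
  obtain ⟨C, hC⟩ := hb.exists_lintegral_le_of_le_div hq c
  refine ⟨C, fun E 𝕜 _ f hf t ht => ?_⟩
  rw [besovNorm_rpow E hq fun u hu => (hb.pos u hu).le]
  exact hC _ _ t ht (modulus_mollify_le hf ht) fun u hu => hc E 𝕜 f hf t u ht hu

theorem le_rpow_one_div {x y : ℝ≥0∞} (hq : 0 < q) (h : x ^ q ≤ y) : x ≤ y ^ (1 / q) := by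
  rwa [one_div, ENNReal.le_rpow_inv_iff hq]

theorem exists_kFunctional_le (n : ℕ) (hq₀ : 0 < q₀) (hq₁ : 0 < q₁)
    (hb₀ : SlowlyVaryingZero q₀ b₀) (hb₁ : SlowlyVaryingZero q₁ b₁)
    (S : DyadicScale q₀ q₁ b₀ b₁) : ∃ C₀ C₁ : ℝ≥0, ∀ (E : RIFunctionNorm n) (𝕜 : Type*)
    [RCLike 𝕜], ∀ f ∈ E.space 𝕜, ∀ k : ℤ,
      kFunctional (besovSpace E 𝕜 q₀ b₀) (besovSpace E 𝕜 q₁ b₁) (besovNorm E q₀ b₀)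
        (besovNorm E q₁ b₁) (2 ^ k) f ≤
      (C₀ * ∑' i : ℕ, tailWeighted q₀ b₀ (modulus E f) (S.t (k + -(i : ℤ))) ^ q₀) ^ (1 / q₀) +
      ENNReal.ofReal (2 ^ k) *
        (C₁ * ∑' i : ℕ, tailWeighted q₁ b₁ (modulus E f) (S.t (k + i)) ^ q₁) ^ (1 / q₁) := by
  obtain ⟨c, hc⟩ := exists_besovNorm_mollify_rpow_le n hq₁ hb₁
  lift 2 ^ q₀ * (ENNReal.ofReal S.ratio ^ q₀ + 1) to ℝ≥0 using by finiteness with C₀ hC₀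
  lift c * (1 + ENNReal.ofReal S.ratio ^ q₁) to ℝ≥0 using by finiteness with C₁ hC₁
  refine ⟨C₀, C₁, fun E 𝕜 _ f hf k => ?_⟩
  have hω := modulus_mono (E := E) f
  have hbound₀ : besovNorm E q₀ b₀ (f - mollify (S.t k) f) ^ q₀ ≤
      C₀ * ∑' i : ℕ, tailWeighted q₀ b₀ (modulus E f) (S.t (k + -(i : ℤ))) ^ q₀ := by
    refine (besovNorm_sub_mollify_rpow_le E hq₀ hb₀ hf (S.pos k)).trans ?_
    rw [hC₀, mul_assoc, add_mul, one_mul]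
    gcongr
    · exact S.lintegral_Ioc_zero_le hq₀ hq₁ hb₀ hb₁ hω k
    · simpa using ENNReal.le_tsum
        (f := fun i : ℕ => tailWeighted q₀ b₀ (modulus E f) (S.t (k + -(i : ℤ))) ^ q₀) 0
  have hbound₁ : besovNorm E q₁ b₁ (mollify (S.t k) f) ^ q₁ ≤
      C₁ * ∑' i : ℕ, tailWeighted q₁ b₁ (modulus E f) (S.t (k + i)) ^ q₁ := by
    refine (hc E 𝕜 f hf _ (S.pos k)).trans ?_
    rw [hC₁, mul_assoc, add_mul, one_mul]
    gcongr
    · simpa using ENNReal.le_tsum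
        (f := fun i : ℕ => tailWeighted q₁ b₁ (modulus E f) (S.t (k + i)) ^ q₁) 0
    · exact S.lintegral_Ioi_le hq₁ hb₁ hω k
  have hmem₀ : besovNorm E q₀ b₀ (f - mollify (S.t k) f) < ∞ →
      f - mollify (S.t k) f ∈ besovSpace E 𝕜 q₀ b₀ :=
    fun hfin => ⟨sub_mollify_mem_space hf (S.pos k), hfin⟩
  have hmem₁ : besovNorm E q₁ b₁ (mollify (S.t k) f) < ∞ →
      mollify (S.t k) f ∈ besovSpace E 𝕜 q₁ b₁ :=
    fun hfin => ⟨mollify_mem_space hf (S.pos k), hfin⟩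
  refine (kFunctional_le_of_lt_top_imp_mem hmem₀ hmem₁ (sub_add_cancel f _).symm
    (zpow_pos two_pos k)).trans ?_
  gcongr
  · exact le_rpow_one_div hq₀ hbound₀
  · exact le_rpow_one_div hq₁ hbound₁

end Besov

section Blocks

variable {q q₀ q₁ θ : ℝ} {b b₀ b₁ : ℝ → ℝ} {t : ℝ}

theorem SlowlyVarying.exists_lintegral_Ioc_two_mul_le (hq : 0 < q) (hb : SlowlyVarying b)
    (α : ℝ) : ∃ C : ℝ≥0, ∀ K : ℝ → ℝ≥0∞, Monotone K → ∀ x : ℝ, 0 < x →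
      ∫⁻ s in Ioc x (2 * x), logWeight q (fun s => s ^ α * b s) s * K s ^ q ≤
        C * (ENNReal.ofReal ((2 * x) ^ α * b (2 * x)) * K (2 * x)) ^ q := by
  obtain ⟨c, hc, hle⟩ := hb.exists_rpow_mul_le α
  lift ENNReal.ofReal c ^ q to ℝ≥0 using by finiteness with C hC
  refine ⟨C, fun K hK x hx => ?_⟩
  have hweight : ∀ s ∈ Ioc x (2 * x),
      0 ≤ s ^ α * b s ∧ s ^ α * b s ≤ c * ((2 * x) ^ α * b (2 * x)) := fun s hs => by
    have hs0 := hx.trans hs.1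
    have hbs := hb.pos s hs0
    exact ⟨by positivity, hle s (2 * x) hs0 (by positivity) (by linarith [hs.2])
      (by linarith [hs.1])⟩
  refine (setLIntegral_logWeight_mul_le hq hx hweight fun s hs => hK hs.2).trans_eq ?_
  rw [two_mul, add_sub_cancel_right, div_self hx.ne', ENNReal.ofReal_one, one_mul,
    ENNReal.ofReal_mul hc.le, mul_assoc, ENNReal.mul_rpow_of_nonneg _ _ hq.le, hC]

theorem SlowlyVarying.exists_le_lintegral_Ioc_two_mul (hq : 0 < q) (hb : SlowlyVarying b)
    (α : ℝ) : ∃ C : ℝ≥0, ∀ K : ℝ → ℝ≥0∞, Monotone K → ∀ x : ℝ, 0 < x →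
      (ENNReal.ofReal (x ^ α * b x) * K x) ^ q ≤
        C * ∫⁻ s in Ioc x (2 * x), logWeight q (fun s => s ^ α * b s) s * K s ^ q := by
  obtain ⟨c, hc, hle⟩ := hb.exists_rpow_mul_le α
  lift ENNReal.ofReal c ^ q * 2 to ℝ≥0 using by finiteness with C hC
  refine ⟨C, fun K hK x hx => ?_⟩
  have hbx := hb.pos x hx
  have hweight : ∀ s ∈ Ioc x (2 * x), x ^ α * b x / c ≤ s ^ α * b s := fun s hs =>
    (div_le_iff₀' hc).2 (hle x s hx (hx.trans hs.1) (by linarith [hs.1]) hs.2)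
  calc (ENNReal.ofReal (x ^ α * b x) * K x) ^ q
      = ENNReal.ofReal c ^ q * (ENNReal.ofReal (x ^ α * b x / c) * K x) ^ q := by
        rw [← ENNReal.mul_rpow_of_nonneg _ _ hq.le, ← mul_assoc, ← ENNReal.ofReal_mul hc.le,
          mul_div_cancel₀ _ hc.ne']
    _ ≤ _ := by
        rw [hC, mul_assoc]
        exact mul_le_mul_right (rpow_le_two_mul_setLIntegral_logWeight hq hx (by positivity)
          hweight fun s hs => hK hs.1.le) _

theorem bTilde_nonneg (hq₀ : 0 < q₀) (hq₁ : 0 < q₁) (hb₀ : SlowlyVaryingZero q₀ b₀)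
    (hb₁ : SlowlyVaryingZero q₁ b₁) (hb : SlowlyVarying b) (ht : 0 < t) :
    0 ≤ bTilde θ q q₀ q₁ b b₀ b₁ t := by
  have hρ := rho_pos hq₀ hq₁ hb₀ hb₁ ht
  have hbρ := hb.pos _ hρ
  have hb₁t := hb₁.pos t ht
  have hT := hb₁.tailNorm_pos hq₁ ht
  rw [bTilde, hb₁.setIntegral_Ioi_rpow_div hq₁ ht]
  positivity

theorem bTilde_rpow_mul (hq : 0 < q) (hq₀ : 0 < q₀) (hq₁ : 0 < q₁)
    (hb₀ : SlowlyVaryingZero q₀ b₀) (hb₁ : SlowlyVaryingZero q₁ b₁) (hb : SlowlyVarying b)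
    (ht : 0 < t) :
    bTilde θ q q₀ q₁ b b₀ b₁ t ^ q * tailNorm q₁ b₁ t ^ q₁ =
      (rho q₀ q₁ b₀ b₁ t ^ (1 - θ) * b (rho q₀ q₁ b₀ b₁ t) * tailNorm q₁ b₁ t) ^ q *
        b₁ t ^ q₁ := by
  have hρ := rho_pos hq₀ hq₁ hb₀ hb₁ ht
  have hbρ := hb.pos _ hρ
  have hb₁t := hb₁.pos t ht
  have hT := hb₁.tailNorm_pos hq₁ ht
  have hTpow : ((tailNorm q₁ b₁ t ^ q₁) ^ (1 / q₁ - 1 / q)) ^ q * tailNorm q₁ b₁ t ^ q₁ =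
      tailNorm q₁ b₁ t ^ q := by
    rw [← Real.rpow_mul hT.le, ← Real.rpow_mul hT.le, ← Real.rpow_add hT]
    congr 1
    field_simp
    ring
  have hbpow : (b₁ t ^ (q₁ / q)) ^ q = b₁ t ^ q₁ := by
    rw [← Real.rpow_mul hb₁t.le, div_mul_cancel₀ _ hq.ne']
  rw [bTilde, hb₁.setIntegral_Ioi_rpow_div hq₁ ht, Real.mul_rpow (by positivity) (by positivity),
    mul_assoc, hTpow, Real.mul_rpow (by positivity) (by positivity), hbpow,
    Real.mul_rpow (y := tailNorm q₁ b₁ t) (by positivity) hT.le]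
  ring

theorem logWeight_bTilde_mul (hq : 0 < q) (hq₀ : 0 < q₀) (hq₁ : 0 < q₁)
    (hb₀ : SlowlyVaryingZero q₀ b₀) (hb₁ : SlowlyVaryingZero q₁ b₁) (hb : SlowlyVarying b)
    (ω : ℝ → ℝ≥0∞) (ht : 0 < t) :
    ENNReal.ofReal (tailNorm q₁ b₁ t) ^ q₁ *
        (logWeight q (bTilde θ q q₀ q₁ b b₀ b₁) t * ω t ^ q) =
      logWeight q₁ b₁ t *
        (ENNReal.ofReal (rho q₀ q₁ b₀ b₁ t ^ (1 - θ) * b (rho q₀ q₁ b₀ b₁ t)) *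
          tailWeighted q₁ b₁ ω t) ^ q := by
  have hρ := rho_pos hq₀ hq₁ hb₀ hb₁ ht
  have hbρ := hb.pos _ hρ
  have hb₁t := hb₁.pos t ht
  have hT := hb₁.tailNorm_pos hq₁ ht
  rw [tailWeighted, ← mul_assoc (ENNReal.ofReal (rho q₀ q₁ b₀ b₁ t ^ (1 - θ) * _)),
    ← ENNReal.ofReal_mul (by positivity), ENNReal.mul_rpow_of_nonneg _ _ hq.le, ← mul_assoc,
    ← mul_assoc, logWeight, logWeight, ENNReal.ofReal_rpow_of_nonneg hT.le hq₁.le,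
    ENNReal.ofReal_rpow_of_nonneg (by positivity) hq.le, ← ENNReal.ofReal_mul (by positivity),
    ← ENNReal.ofReal_mul (by positivity), mul_div_assoc', mul_comm (tailNorm q₁ b₁ t ^ q₁),
    bTilde_rpow_mul hq hq₀ hq₁ hb₀ hb₁ hb ht, div_mul_eq_mul_div, mul_comm (b₁ t ^ q₁)]

namespace DyadicScale

variable (S : DyadicScale q₀ q₁ b₀ b₁)

theorem exists_weight_mul_tailWeighted_le (hq₀ : 0 < q₀) (hq₁ : 0 < q₁)
    (hb₀ : SlowlyVaryingZero q₀ b₀) (hb₁ : SlowlyVaryingZero q₁ b₁) (hb : SlowlyVarying b)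
    (hmono : MonotoneOn (rho q₀ q₁ b₀ b₁) (Ioi 0)) (α : ℝ) :
    ∃ C : ℝ≥0, ∀ ω : ℝ → ℝ≥0∞, Monotone ω → ∀ k, ∀ u ∈ Ioc (S.t k) (S.t (k + 1)),
      ENNReal.ofReal (rho q₀ q₁ b₀ b₁ u ^ α * b (rho q₀ q₁ b₀ b₁ u)) * tailWeighted q₁ b₁ ω u ≤
        C * (ENNReal.ofReal ((2 ^ (k + 1)) ^ α * b (2 ^ (k + 1))) *
          tailWeighted q₁ b₁ ω (S.t (k + 1))) ∧
      ENNReal.ofReal ((2 ^ k) ^ α * b (2 ^ k)) * tailWeighted q₁ b₁ ω (S.t k) ≤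
        C * (ENNReal.ofReal (rho q₀ q₁ b₀ b₁ u ^ α * b (rho q₀ q₁ b₀ b₁ u)) *
          tailWeighted q₁ b₁ ω u) := by
  obtain ⟨c, hc, hle⟩ := hb.exists_rpow_mul_le α
  have hratio : 0 ≤ S.ratio := zero_le_one.trans S.one_le_ratio
  refine ⟨c.toNNReal * S.ratio.toNNReal, fun ω hω k u hu => ?_⟩
  have hu0 := (S.pos k).trans hu.1
  have hρ := rho_pos hq₀ hq₁ hb₀ hb₁ hu0
  have hpow := zpow_pos (zero_lt_two' ℝ) k
  have hsucc : (2 : ℝ) ^ (k + 1) = 2 * 2 ^ k := by rw [zpow_add_one₀ two_ne_zero, mul_comm]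
  obtain ⟨hρ_ge, hρ_le⟩ := S.rho_mem hmono hu
  have hTk := hb₁.tailNorm_antitoneOn hq₁ (S.pos k) hu0 hu.1.le
  have hTk1 := hb₁.tailNorm_antitoneOn hq₁ hu0 (S.pos (k + 1)) hu.2
  have hTratio := S.tailNorm_le_ratio_mul k
  have combine : ∀ {v v' T T' : ℝ} {x x' : ℝ≥0∞}, v ≤ c * v' → T ≤ S.ratio * T' → x ≤ x' →
      ENNReal.ofReal v * (ENNReal.ofReal T * x) ≤ (c.toNNReal * S.ratio.toNNReal : ℝ≥0) *
        (ENNReal.ofReal v' * (ENNReal.ofReal T' * x')) := fun hv hT hx => by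
    rw [ENNReal.coe_mul, ENNReal.ofNNReal_toNNReal, ENNReal.ofNNReal_toNNReal, mul_mul_mul_comm,
      ← mul_assoc (ENNReal.ofReal S.ratio), ← ENNReal.ofReal_mul hc.le, ← ENNReal.ofReal_mul hratio]
    gcongr
  constructor
  · exact combine (hle _ _ hρ (zpow_pos two_pos _) (by linarith) (by linarith))
      (hTk.trans hTratio) (hω hu.2)
  · exact combine (hle _ _ hpow hρ (by linarith) hρ_le)
      (hTratio.trans (mul_le_mul_of_nonneg_left hTk1 hratio)) (hω hu.1.le)

theorem lintegral_Ioc_logWeight_le (hq₁ : 0 < q₁) (hb₁ : SlowlyVaryingZero q₁ b₁) (k : ℤ) :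
    ∫⁻ u in Ioc (S.t k) (S.t (k + 1)), logWeight q₁ b₁ u ≤
      ENNReal.ofReal S.ratio ^ q₁ * ENNReal.ofReal (tailNorm q₁ b₁ (S.t (k + 1))) ^ q₁ := by
  rw [← ENNReal.mul_rpow_of_nonneg _ _ hq₁.le,
    ← ENNReal.ofReal_mul (zero_le_one.trans S.one_le_ratio),
    hb₁.lintegral_Ioc_logWeight hq₁ (S.pos k) (S.strictMono (lt_add_one k)).le]
  refine tsub_le_self.trans ?_
  gcongr
  exact S.tailNorm_le_ratio_mul k

theorem exists_tailNorm_rpow_le_lintegral (hq₁ : 0 < q₁) (hb₁ : SlowlyVaryingZero q₁ b₁) :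
    ∃ C : ℝ≥0, ∀ k, ENNReal.ofReal (tailNorm q₁ b₁ (S.t k)) ^ q₁ ≤
      C * ∫⁻ u in Ioc (S.t k) (S.t (k + 1)), logWeight q₁ b₁ u := by
  have hδ : 0 < 1 - (2 ^ q₁ : ℝ)⁻¹ :=
    sub_pos.2 (inv_lt_one_of_one_lt₀ (Real.one_lt_rpow one_lt_two hq₁))
  refine ⟨(1 - (2 ^ q₁ : ℝ)⁻¹)⁻¹.toNNReal, fun k => ?_⟩
  have hT := hb₁.tailNorm_pos hq₁ (S.pos k)
  have hT' := hb₁.tailNorm_pos hq₁ (S.pos (k + 1))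
  have hdrop : tailNorm q₁ b₁ (S.t (k + 1)) ^ q₁ ≤
      (2 ^ q₁)⁻¹ * tailNorm q₁ b₁ (S.t k) ^ q₁ := by
    rw [le_inv_mul_iff₀ (by positivity), ← Real.mul_rpow zero_le_two hT'.le]
    exact Real.rpow_le_rpow (by positivity) (S.two_mul_tailNorm_le k) hq₁.le
  rw [hb₁.lintegral_Ioc_logWeight hq₁ (S.pos k) (S.strictMono (lt_add_one k)).le,
    ENNReal.ofReal_rpow_of_nonneg hT.le hq₁.le, ENNReal.ofReal_rpow_of_nonneg hT'.le hq₁.le,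
    ← ENNReal.ofReal_sub _ (by positivity), ENNReal.ofNNReal_toNNReal,
    ← ENNReal.ofReal_mul (by positivity)]
  refine ENNReal.ofReal_le_ofReal ?_
  rw [le_inv_mul_iff₀ hδ]
  linarith

theorem exists_lintegral_bTilde_le (hq : 0 < q) (hq₀ : 0 < q₀) (hq₁ : 0 < q₁)
    (hb₀ : SlowlyVaryingZero q₀ b₀) (hb₁ : SlowlyVaryingZero q₁ b₁) (hb : SlowlyVarying b)
    (hmono : MonotoneOn (rho q₀ q₁ b₀ b₁) (Ioi 0)) :
    ∃ C : ℝ≥0, ∀ ω : ℝ → ℝ≥0∞, Monotone ω → ∀ k : ℤ,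
      ∫⁻ u in Ioc (S.t k) (S.t (k + 1)), logWeight q (bTilde θ q q₀ q₁ b b₀ b₁) u * ω u ^ q ≤
        C * (ENNReal.ofReal ((2 ^ (k + 1)) ^ (1 - θ) * b (2 ^ (k + 1))) *
          tailWeighted q₁ b₁ ω (S.t (k + 1))) ^ q := by
  obtain ⟨c, hc⟩ := S.exists_weight_mul_tailWeighted_le hq₀ hq₁ hb₀ hb₁ hb hmono (1 - θ)
  lift (c : ℝ≥0∞) ^ q * ENNReal.ofReal S.ratio ^ q₁ to ℝ≥0 using by finiteness with C hC
  refine ⟨C, fun ω hω k => ?_⟩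
  set X := ENNReal.ofReal ((2 ^ (k + 1)) ^ (1 - θ) * b (2 ^ (k + 1))) *
    tailWeighted q₁ b₁ ω (S.t (k + 1))
  set T := ENNReal.ofReal (tailNorm q₁ b₁ (S.t (k + 1))) ^ q₁
  have hT : 0 < T := ENNReal.rpow_pos
    (ENNReal.ofReal_pos.2 (hb₁.tailNorm_pos hq₁ (S.pos (k + 1)))) ENNReal.ofReal_ne_top
  have hTtop : T ≠ ∞ := by finiteness
  refine (ENNReal.mul_le_mul_iff_right hT.ne' hTtop).1 ?_
  calc T * ∫⁻ u in Ioc (S.t k) (S.t (k + 1)),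
        logWeight q (bTilde θ q q₀ q₁ b b₀ b₁) u * ω u ^ q
      = ∫⁻ u in Ioc (S.t k) (S.t (k + 1)),
          T * (logWeight q (bTilde θ q q₀ q₁ b b₀ b₁) u * ω u ^ q) :=
        (lintegral_const_mul' _ _ hTtop).symm
    _ ≤ ∫⁻ u in Ioc (S.t k) (S.t (k + 1)), logWeight q₁ b₁ u * (c * X) ^ q := by
        refine setLIntegral_mono' measurableSet_Ioc fun u hu => ?_
        have hu0 := (S.pos k).trans hu.1
        have hanti := hb₁.tailNorm_antitoneOn hq₁ hu0 (S.pos (k + 1)) hu.2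
        have hTle : T ≤ ENNReal.ofReal (tailNorm q₁ b₁ u) ^ q₁ :=
          ENNReal.rpow_le_rpow (ENNReal.ofReal_le_ofReal hanti) hq₁.le
        refine (mul_le_mul_left hTle _).trans
          ((logWeight_bTilde_mul hq hq₀ hq₁ hb₀ hb₁ hb ω hu0).trans_le ?_)
        exact mul_le_mul_right (ENNReal.rpow_le_rpow (hc ω hω k u hu).1 hq.le) _
    _ = (∫⁻ u in Ioc (S.t k) (S.t (k + 1)), logWeight q₁ b₁ u) * (c * X) ^ q :=
        lintegral_mul_const'' _ ((aemeasurable_logWeight hb₁.aemeasurable).mono_set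
          (Ioc_subset_Ioi_self.trans (Ioi_subset_Ioi (S.pos k).le)))
    _ ≤ ENNReal.ofReal S.ratio ^ q₁ * T * (c * X) ^ q :=
        mul_le_mul_left (S.lintegral_Ioc_logWeight_le hq₁ hb₁ k) _
    _ = T * (C * X ^ q) := by
        rw [hC, ENNReal.mul_rpow_of_nonneg _ _ hq.le]
        ring

theorem exists_le_lintegral_bTilde (hq : 0 < q) (hq₀ : 0 < q₀) (hq₁ : 0 < q₁)
    (hb₀ : SlowlyVaryingZero q₀ b₀) (hb₁ : SlowlyVaryingZero q₁ b₁) (hb : SlowlyVarying b)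
    (hmono : MonotoneOn (rho q₀ q₁ b₀ b₁) (Ioi 0)) :
    ∃ C : ℝ≥0, ∀ ω : ℝ → ℝ≥0∞, Monotone ω → ∀ k : ℤ,
      (ENNReal.ofReal ((2 ^ k) ^ (1 - θ) * b (2 ^ k)) * tailWeighted q₁ b₁ ω (S.t k)) ^ q ≤
        C * ∫⁻ u in Ioc (S.t k) (S.t (k + 1)),
          logWeight q (bTilde θ q q₀ q₁ b b₀ b₁) u * ω u ^ q := by
  obtain ⟨c, hc⟩ := S.exists_weight_mul_tailWeighted_le hq₀ hq₁ hb₀ hb₁ hb hmono (1 - θ)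
  obtain ⟨d, hd⟩ := S.exists_tailNorm_rpow_le_lintegral hq₁ hb₁
  lift (d : ℝ≥0∞) * c ^ q to ℝ≥0 using by finiteness with C hC
  refine ⟨C, fun ω hω k => ?_⟩
  set X := ENNReal.ofReal ((2 ^ k) ^ (1 - θ) * b (2 ^ k)) * tailWeighted q₁ b₁ ω (S.t k)
  set T := ENNReal.ofReal (tailNorm q₁ b₁ (S.t k)) ^ q₁
  have hT : 0 < T := ENNReal.rpow_pos
    (ENNReal.ofReal_pos.2 (hb₁.tailNorm_pos hq₁ (S.pos k))) ENNReal.ofReal_ne_top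
  have hTtop : T ≠ ∞ := by finiteness
  refine (ENNReal.mul_le_mul_iff_right hT.ne' hTtop).1 ?_
  calc T * X ^ q
      ≤ d * (∫⁻ u in Ioc (S.t k) (S.t (k + 1)), logWeight q₁ b₁ u) * X ^ q :=
        mul_le_mul_left (hd k) _
    _ = d * ∫⁻ u in Ioc (S.t k) (S.t (k + 1)), logWeight q₁ b₁ u * X ^ q := by
        rw [mul_assoc, lintegral_mul_const'' _ ((aemeasurable_logWeight
          hb₁.aemeasurable).mono_set (Ioc_subset_Ioi_self.trans (Ioi_subset_Ioi (S.pos k).le)))]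
    _ ≤ d * ∫⁻ u in Ioc (S.t k) (S.t (k + 1)),
          c ^ q * T * (logWeight q (bTilde θ q q₀ q₁ b b₀ b₁) u * ω u ^ q) := by
        refine mul_le_mul_right (setLIntegral_mono' measurableSet_Ioc fun u hu => ?_) _
        have hu0 := (S.pos k).trans hu.1
        have hanti := hb₁.tailNorm_antitoneOn hq₁ (S.pos k) hu0 hu.1.le
        refine (mul_le_mul_right (ENNReal.rpow_le_rpow (hc ω hω k u hu).2 hq.le) _).trans ?_
        rw [ENNReal.mul_rpow_of_nonneg _ _ hq.le, mul_left_comm, mul_assoc,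
          ← logWeight_bTilde_mul hq hq₀ hq₁ hb₀ hb₁ hb ω hu0]
        gcongr
        exact ENNReal.rpow_le_rpow (ENNReal.ofReal_le_ofReal hanti) hq₁.le
    _ = T * (C * ∫⁻ u in Ioc (S.t k) (S.t (k + 1)),
          logWeight q (bTilde θ q q₀ q₁ b b₀ b₁) u * ω u ^ q) := by
        rw [lintegral_const_mul' _ _ (by finiteness), hC]
        ring

theorem two_zpow_rpow_mul_tailWeighted (hq₁ : 0 < q₁) (hb₁ : SlowlyVaryingZero q₁ b₁)
    (θ : ℝ) (b : ℝ → ℝ) (ω : ℝ → ℝ≥0∞) (k : ℤ) :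
    ENNReal.ofReal ((2 ^ k) ^ (1 - θ) * b (2 ^ k)) * tailWeighted q₁ b₁ ω (S.t k) =
      ENNReal.ofReal ((2 ^ k) ^ (-θ) * b (2 ^ k)) * tailWeighted q₀ b₀ ω (S.t k) := by
  have hpow := zpow_pos (zero_lt_two' ℝ) k
  rw [tailWeighted, tailWeighted, S.tailNorm_zero_eq hq₁ hb₁, sub_eq_add_neg,
    Real.rpow_add hpow, Real.rpow_one, mul_assoc, ENNReal.ofReal_mul hpow.le,
    ENNReal.ofReal_mul hpow.le]
  ring

end DyadicScale

end Blocks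

section Equivalence

variable {q q₀ q₁ θ : ℝ} {b b₀ b₁ : ℝ → ℝ}

theorem kInterpNorm_rpow {V : Type*} [AddCommGroup V] (A₀ A₁ : Set V) (N₀ N₁ : V → ℝ≥0∞)
    (hq : 0 < q) (hb : ∀ s, 0 < s → 0 ≤ b s) (f : V) :
    kInterpNorm A₀ A₁ N₀ N₁ θ q b f ^ q = ∫⁻ s in Ioi 0,
      logWeight q (fun s => s ^ (-θ) * b s) s * kFunctional A₀ A₁ N₀ N₁ s f ^ q := by
  rw [kInterpNorm, eLpNorm'_eq_lintegral_enorm, ← ENNReal.rpow_mul, one_div_mul_cancel hq.ne',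
    ENNReal.rpow_one]
  refine setLIntegral_congr_fun measurableSet_Ioi fun s (hs : 0 < s) => ?_
  have hbs := hb s hs
  have hsplit : s ^ (-θ - 1 / q) * b s = s ^ (-(1 / q)) * (s ^ (-θ) * b s) := by
    rw [← mul_assoc, ← Real.rpow_add hs, ← sub_eq_neg_add]
  rw [enorm_eq_self, hsplit, ENNReal.mul_rpow_of_nonneg _ _ hq.le,
    ofReal_rpow_neg_mul_rpow hq hs (by positivity), logWeight]

theorem mem_add_of_kInterpNorm_lt_top {V : Type*} [AddCommGroup V] {A₀ A₁ : Set V}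
    {N₀ N₁ : V → ℝ≥0∞} (hq : 0 < q) (hb : ∀ s, 0 < s → 0 < b s) {f : V}
    (hf : kInterpNorm A₀ A₁ N₀ N₁ θ q b f < ∞) : f ∈ A₀ + A₁ := by
  by_contra hmem
  have hK : ∀ s, kFunctional A₀ A₁ N₀ N₁ s f = ∞ := fun s => by
    simp only [kFunctional, iInf_eq_top]
    exact fun f₀ hf₀ f₁ hf₁ heq => absurd (heq ▸ Set.add_mem_add hf₀ hf₁) hmem
  refine (ENNReal.rpow_lt_top_of_nonneg hq.le hf.ne).ne (top_unique ?_)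
  calc ∞ = ∫⁻ _ in Ioi (0 : ℝ), ∞ := by
        rw [setLIntegral_const, Real.volume_Ioi, ENNReal.top_mul_top]
    _ ≤ ∫⁻ s in Ioi 0,
          logWeight q (fun s => s ^ (-θ) * b s) s * kFunctional A₀ A₁ N₀ N₁ s f ^ q := by
        refine setLIntegral_mono' measurableSet_Ioi fun s (hs : 0 < s) => ?_
        have hbs := hb s hs
        rw [hK, ENNReal.top_rpow_of_pos hq, ENNReal.mul_top]
        exact (ENNReal.ofReal_pos.2 (by positivity)).ne'
    _ = kInterpNorm A₀ A₁ N₀ N₁ θ q b f ^ q :=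
        (kInterpNorm_rpow A₀ A₁ N₀ N₁ hq (fun s hs => (hb s hs).le) f).symm

theorem le_mul_of_rpow_le {x y : ℝ≥0∞} {c C : ℝ≥0} (hq : 0 < q) (h : x ^ q ≤ c * y ^ q)
    (hC : c ^ (1 / q) ≤ C) : x ≤ C * y := by
  refine (le_rpow_one_div hq h).trans ?_
  rw [ENNReal.mul_rpow_of_nonneg _ _ (by positivity), ← ENNReal.rpow_mul,
    mul_one_div_cancel hq.ne', ENNReal.rpow_one, ← ENNReal.coe_rpow_of_nonneg _ (by positivity)]
  gcongr

namespace DyadicScale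

variable (S : DyadicScale q₀ q₁ b₀ b₁)

theorem exists_tsum_rpow_le (hq : 0 < q) (hq₀ : 0 < q₀) (hq₁ : 0 < q₁)
    (hb₁ : SlowlyVaryingZero q₁ b₁) (hb : SlowlyVarying b) (hθ₀ : 0 < θ) (hθ₁ : θ < 1)
    (c₀ c₁ : ℝ≥0) :
    ∃ C : ℝ≥0, ∀ (ω : ℝ → ℝ≥0∞) (K : ℤ → ℝ≥0∞),
      (∀ k, K k ≤
        (c₀ * ∑' i : ℕ, tailWeighted q₀ b₀ ω (S.t (k + -(i : ℤ))) ^ q₀) ^ (1 / q₀) +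
        ENNReal.ofReal (2 ^ k) *
          (c₁ * ∑' i : ℕ, tailWeighted q₁ b₁ ω (S.t (k + i)) ^ q₁) ^ (1 / q₁)) →
      ∑' k : ℤ, (ENNReal.ofReal ((2 ^ k) ^ (-θ) * b (2 ^ k)) * K k) ^ q ≤
        C * ∑' k : ℤ, (ENNReal.ofReal ((2 ^ k) ^ (1 - θ) * b (2 ^ k)) *
          tailWeighted q₁ b₁ ω (S.t k)) ^ q := by
  let W (α : ℝ) (k : ℤ) : ℝ≥0∞ := ENNReal.ofReal ((2 ^ k) ^ α * b (2 ^ k))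
  obtain ⟨d₀, μ₀, hμ₀, hd₀⟩ := hb.exists_dyadic_le (neg_ne_zero.2 hθ₀.ne')
  obtain ⟨d₁, μ₁, hμ₁, hd₁⟩ := hb.exists_dyadic_le (sub_pos.2 hθ₁).ne'
  obtain ⟨H₀, hH₀⟩ := exists_tsum_mul_tsum_rpow_le hμ₀ hq₀ hq d₀ c₀
  obtain ⟨H₁, hH₁⟩ := exists_tsum_mul_tsum_rpow_le hμ₁ hq₁ hq d₁ c₁
  lift (2 : ℝ≥0∞) ^ q * (H₀ + H₁) to ℝ≥0 using by finiteness with C hC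
  refine ⟨C, fun ω K hK => ?_⟩
  let A (k : ℤ) := tailWeighted q₀ b₀ ω (S.t k)
  let B (k : ℤ) := tailWeighted q₁ b₁ ω (S.t k)
  have hbalance : ∀ k, W (1 - θ) k * B k = W (-θ) k * A k :=
    S.two_zpow_rpow_mul_tailWeighted hq₁ hb₁ θ b ω
  have hshift : ∀ k : ℤ, W (-θ) k * ENNReal.ofReal (2 ^ k) = W (1 - θ) k := fun k => by
    have hpow := zpow_pos (zero_lt_two' ℝ) k
    change ENNReal.ofReal _ * _ = ENNReal.ofReal _
    rw [← ENNReal.ofReal_mul' hpow.le, sub_eq_neg_add, Real.rpow_add_one hpow.ne', mul_right_comm]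
  have hdecay : ∀ (k : ℤ) (i : ℕ), W (-θ) k ≤ d₀ * μ₀ ^ i * W (-θ) (k + -(i : ℤ)) := fun k i => by
    have hsign : 0 ≤ -θ * (-(i : ℤ) : ℤ) := by push_cast; rw [neg_mul_neg]; positivity
    simpa using hd₀ k (-(i : ℤ)) hsign
  have hgrowth : ∀ (k : ℤ) (i : ℕ), W (1 - θ) k ≤ d₁ * μ₁ ^ i * W (1 - θ) (k + i) := fun k i => by
    have hsign : 0 ≤ (1 - θ) * (i : ℤ) := mul_nonneg (by linarith) (by positivity)
    simpa using hd₁ k i hsign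
  calc ∑' k, (W (-θ) k * K k) ^ q
      ≤ ∑' k, 2 ^ q * ((W (-θ) k * (c₀ * ∑' i : ℕ, A (k + -(i : ℤ)) ^ q₀) ^ (1 / q₀)) ^ q +
          (W (1 - θ) k * (c₁ * ∑' i : ℕ, B (k + i) ^ q₁) ^ (1 / q₁)) ^ q) := by
        refine ENNReal.tsum_le_tsum fun k => ?_
        refine le_trans (ENNReal.rpow_le_rpow ?_ hq.le) (add_rpow_le_two_rpow_mul _ _ hq.le)
        rw [← hshift, mul_assoc, ← mul_add]
        exact mul_le_mul_right (hK k) _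
    _ ≤ 2 ^ q * (H₀ * ∑' k, (W (-θ) k * A k) ^ q + H₁ * ∑' k, (W (1 - θ) k * B k) ^ q) := by
        rw [ENNReal.tsum_mul_left, ENNReal.tsum_add]
        exact mul_le_mul_right (add_le_add (hH₀ (fun i => -(i : ℤ)) _ A hdecay)
          (hH₁ (fun i => (i : ℤ)) _ B hgrowth)) _
    _ = C * ∑' k, (W (1 - θ) k * B k) ^ q := by
        simp_rw [hbalance]
        rw [hC, ← add_mul, mul_assoc]

end DyadicScale

variable {n : ℕ} {𝕜 : Type*} [RCLike 𝕜]

theorem exists_besovNorm_le_kInterpNorm (E : RIFunctionNorm n) (S : DyadicScale q₀ q₁ b₀ b₁)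
    (hq : 0 < q) (hq₀ : 0 < q₀) (hq₁ : 0 < q₁) (hb₀ : SlowlyVaryingZero q₀ b₀)
    (hb₁ : SlowlyVaryingZero q₁ b₁) (hb : SlowlyVarying b)
    (hmono : MonotoneOn (rho q₀ q₁ b₀ b₁) (Ioi 0)) :
    ∃ C : ℝ≥0, ∀ f : EuclideanSpace ℝ (Fin n) →ₘ[volume] 𝕜,
      besovNorm E q (bTilde θ q q₀ q₁ b b₀ b₁) f ^ q ≤
        C * kInterpNorm (besovSpace E 𝕜 q₀ b₀) (besovSpace E 𝕜 q₁ b₁)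
          (besovNorm E q₀ b₀) (besovNorm E q₁ b₁) θ q b f ^ q := by
  obtain ⟨C, hC⟩ := S.exists_lintegral_bTilde_le (θ := θ) hq hq₀ hq₁ hb₀ hb₁ hb hmono
  obtain ⟨C', hC'⟩ := hb.exists_le_lintegral_Ioc_two_mul hq (-θ)
  refine ⟨C * C', fun f => ?_⟩
  let g (k : ℤ) := (ENNReal.ofReal ((2 ^ k) ^ (1 - θ) * b (2 ^ k)) *
    tailWeighted q₁ b₁ (modulus E f) (S.t k)) ^ q
  have hle_K : ∀ k, tailWeighted q₀ b₀ (modulus E f) (S.t k) ≤ kFunctional (besovSpace E 𝕜 q₀ b₀)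
      (besovSpace E 𝕜 q₁ b₁) (besovNorm E q₀ b₀) (besovNorm E q₁ b₁) (2 ^ k) f := fun k => by
    rw [← S.rho_eq]
    exact tailWeighted_modulus_le_kFunctional E hq₀ hq₁ hb₀ hb₁ f (S.pos k)
  rw [besovNorm_rpow E hq fun u hu => bTilde_nonneg hq₀ hq₁ hb₀ hb₁ hb hu,
    lintegral_Ioi_zero_eq_tsum S.strictMono.monotone S.pos S.cover,
    kInterpNorm_rpow _ _ _ _ hq fun s hs => (hb.pos s hs).le, lintegral_Ioi_zero_eq_tsum_dyadic]
  calc ∑' k, ∫⁻ u in Ioc (S.t k) (S.t (k + 1)),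
        logWeight q (bTilde θ q q₀ q₁ b b₀ b₁) u * modulus E f u ^ q
      ≤ ∑' k, C * g (k + 1) := ENNReal.tsum_le_tsum fun k => hC _ (modulus_mono f) k
    _ = C * ∑' k, g k :=
        ENNReal.tsum_mul_left.trans (congrArg _ ((Equiv.addRight (1 : ℤ)).tsum_eq g))
    _ ≤ C * ∑' k : ℤ, C' * ∫⁻ s in Ioc ((2 : ℝ) ^ k) (2 * 2 ^ k),
          logWeight q (fun s => s ^ (-θ) * b s) s * kFunctional (besovSpace E 𝕜 q₀ b₀)
            (besovSpace E 𝕜 q₁ b₁) (besovNorm E q₀ b₀) (besovNorm E q₁ b₁) s f ^ q := by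
        refine mul_le_mul_right (ENNReal.tsum_le_tsum fun k => ?_) _
        refine le_trans (ENNReal.rpow_le_rpow ?_ hq.le)
          (hC' _ (kFunctional_mono _ _ _ _ f) _ (zpow_pos zero_lt_two k))
        rw [S.two_zpow_rpow_mul_tailWeighted hq₁ hb₁]
        exact mul_le_mul_right (hle_K k) _
    _ = _ := by rw [ENNReal.tsum_mul_left, ENNReal.coe_mul, mul_assoc]

theorem exists_kInterpNorm_le_besovNorm (E : RIFunctionNorm n) (S : DyadicScale q₀ q₁ b₀ b₁)
    (hq : 0 < q) (hq₀ : 0 < q₀) (hq₁ : 0 < q₁) (hb₀ : SlowlyVaryingZero q₀ b₀)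
    (hb₁ : SlowlyVaryingZero q₁ b₁) (hb : SlowlyVarying b) (hθ₀ : 0 < θ) (hθ₁ : θ < 1)
    (hmono : MonotoneOn (rho q₀ q₁ b₀ b₁) (Ioi 0)) :
    ∃ C : ℝ≥0, ∀ f ∈ E.space 𝕜,
      kInterpNorm (besovSpace E 𝕜 q₀ b₀) (besovSpace E 𝕜 q₁ b₁)
        (besovNorm E q₀ b₀) (besovNorm E q₁ b₁) θ q b f ^ q ≤
      C * besovNorm E q (bTilde θ q q₀ q₁ b b₀ b₁) f ^ q := by
  obtain ⟨C₁, hC₁⟩ := hb.exists_lintegral_Ioc_two_mul_le hq (-θ)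
  obtain ⟨C₂, hC₂⟩ := S.exists_le_lintegral_bTilde (θ := θ) hq hq₀ hq₁ hb₀ hb₁ hb hmono
  obtain ⟨c₀, c₁, hK⟩ := exists_kFunctional_le n hq₀ hq₁ hb₀ hb₁ S
  obtain ⟨H, hH⟩ := S.exists_tsum_rpow_le hq hq₀ hq₁ hb₁ hb hθ₀ hθ₁ c₀ c₁
  refine ⟨C₁ * (H * C₂), fun f hf => ?_⟩
  let K (s : ℝ) := kFunctional (besovSpace E 𝕜 q₀ b₀) (besovSpace E 𝕜 q₁ b₁)
    (besovNorm E q₀ b₀) (besovNorm E q₁ b₁) s f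
  let g (k : ℤ) := (ENNReal.ofReal ((2 ^ k) ^ (-θ) * b (2 ^ k)) * K (2 ^ k)) ^ q
  rw [besovNorm_rpow E hq fun u hu => bTilde_nonneg hq₀ hq₁ hb₀ hb₁ hb hu,
    kInterpNorm_rpow _ _ _ _ hq fun s hs => (hb.pos s hs).le, lintegral_Ioi_zero_eq_tsum_dyadic,
    lintegral_Ioi_zero_eq_tsum S.strictMono.monotone S.pos S.cover]
  calc ∑' k : ℤ, ∫⁻ s in Ioc ((2 : ℝ) ^ k) (2 * 2 ^ k),
        logWeight q (fun s => s ^ (-θ) * b s) s * K s ^ q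
      ≤ ∑' k, C₁ * g (k + 1) := by
        refine ENNReal.tsum_le_tsum fun k => ?_
        simpa only [g, zpow_add_one₀ (two_ne_zero' ℝ), mul_comm _ (2 : ℝ)] using
          hC₁ K (kFunctional_mono _ _ _ _ f) _ (zpow_pos zero_lt_two k)
    _ = C₁ * ∑' k, g k :=
        ENNReal.tsum_mul_left.trans (congrArg _ ((Equiv.addRight (1 : ℤ)).tsum_eq g))
    _ ≤ C₁ * (H * ∑' k : ℤ, (ENNReal.ofReal ((2 ^ k) ^ (1 - θ) * b (2 ^ k)) *
          tailWeighted q₁ b₁ (modulus E f) (S.t k)) ^ q) :=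
        mul_le_mul_right (hH _ _ (hK E 𝕜 f hf)) _
    _ ≤ C₁ * (H * ∑' k, C₂ * ∫⁻ u in Ioc (S.t k) (S.t (k + 1)),
          logWeight q (bTilde θ q q₀ q₁ b b₀ b₁) u * modulus E f u ^ q) :=
        mul_le_mul_right (mul_le_mul_right
          (ENNReal.tsum_le_tsum fun k => hC₂ _ (modulus_mono f) k) _) _
    _ = _ := by rw [ENNReal.tsum_mul_left, ENNReal.coe_mul, ENNReal.coe_mul, mul_assoc, mul_assoc]

end Equivalence

end LimitingInterpolation

open LimitingInterpolation in
theorem mainTheorem12_general {n : ℕ} {𝕜 : Type*} [RCLike 𝕜] (E : RIFunctionNorm n)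
    (q₀ q₁ q θ : ℝ) (hq₀ : 0 < q₀) (hq₁ : 0 < q₁) (hq : 0 < q)
    (hθ₀ : 0 < θ) (hθ₁ : θ < 1)
    (b₀ b₁ b : ℝ → ℝ) (hb₀ : SlowlyVaryingZero q₀ b₀) (hb₁ : SlowlyVaryingZero q₁ b₁)
    (hb : SlowlyVarying b)
    (hcond : RhoCondition q₀ q₁ b₀ b₁)
    (hmono : MonotoneOn (rho q₀ q₁ b₀ b₁) (Set.Ioi 0))
    (hzero : Filter.Tendsto (rho q₀ q₁ b₀ b₁) (𝓝[>] 0) (𝓝 0))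
    (htop : Filter.Tendsto (rho q₀ q₁ b₀ b₁) Filter.atTop Filter.atTop) :
    kInterpSpace (besovSpace E 𝕜 q₀ b₀) (besovSpace E 𝕜 q₁ b₁)
        (besovNorm E q₀ b₀) (besovNorm E q₁ b₁) θ q b =
      besovSpace E 𝕜 q (bTilde θ q q₀ q₁ b b₀ b₁) ∧
    ∃ C : ℝ≥0, ∀ f ∈ besovSpace E 𝕜 q (bTilde θ q q₀ q₁ b b₀ b₁),
      kInterpNorm (besovSpace E 𝕜 q₀ b₀) (besovSpace E 𝕜 q₁ b₁)
          (besovNorm E q₀ b₀) (besovNorm E q₁ b₁) θ q b f ≤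
        C * besovNorm E q (bTilde θ q q₀ q₁ b b₀ b₁) f ∧
      besovNorm E q (bTilde θ q q₀ q₁ b b₀ b₁) f ≤
        C * kInterpNorm (besovSpace E 𝕜 q₀ b₀) (besovSpace E 𝕜 q₁ b₁)
          (besovNorm E q₀ b₀) (besovNorm E q₁ b₁) θ q b f := by
  obtain ⟨S⟩ := nonempty_dyadicScale hq₀ hq₁ hb₀ hb₁ hcond hmono hzero htop
  obtain ⟨c, hc⟩ := exists_kInterpNorm_le_besovNorm (𝕜 := 𝕜) E S hq hq₀ hq₁ hb₀ hb₁ hb hθ₀ hθ₁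
    hmono
  obtain ⟨d, hd⟩ := exists_besovNorm_le_kInterpNorm (𝕜 := 𝕜) E S hq hq₀ hq₁ hb₀ hb₁ hb hmono
  set C : ℝ≥0 := max (c ^ (1 / q)) (d ^ (1 / q))
  have hkInterp_le := fun f hf => le_mul_of_rpow_le hq (hc f hf) (le_max_left _ _ : _ ≤ C)
  have hbesov_le := fun f => le_mul_of_rpow_le hq (hd f) (le_max_right _ _ : _ ≤ C)
  refine ⟨Set.Subset.antisymm (fun f hf => ?_) (fun f hf => ?_), C,
    fun f hf => ⟨hkInterp_le f hf.1, hbesov_le f⟩⟩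
  · obtain ⟨⟨f₀, hf₀, f₁, hf₁, rfl⟩, hfin⟩ := hf
    exact ⟨E.add_mem_space hf₀.1 hf₁.1,
      (hbesov_le _).trans_lt (ENNReal.mul_lt_top ENNReal.coe_lt_top hfin)⟩
  · have hfin := (hkInterp_le f hf.1).trans_lt (ENNReal.mul_lt_top ENNReal.coe_lt_top hf.2)
    exact ⟨mem_add_of_kInterpNorm_lt_top hq hb.pos hfin, hfin⟩

open LimitingInterpolation in
theorem mainTheorem12 {n : ℕ} {𝕜 : Type*} [RCLike 𝕜] (E : RIFunctionNorm n)
    (q₀ q₁ q θ : ℝ) (hq₀ : 0 < q₀) (hq₁ : 0 < q₁) (hne : q₀ ≠ q₁) (hq : 0 < q)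
    (hθ₀ : 0 < θ) (hθ₁ : θ < 1)
    (b₀ b₁ b : ℝ → ℝ) (hb₀ : SlowlyVaryingZero q₀ b₀) (hb₁ : SlowlyVaryingZero q₁ b₁)
    (hb : SlowlyVarying b)
    (hcond : RhoCondition q₀ q₁ b₀ b₁)
    (hmono : MonotoneOn (rho q₀ q₁ b₀ b₁) (Set.Ioi 0))
    (hzero : Filter.Tendsto (rho q₀ q₁ b₀ b₁) (𝓝[>] 0) (𝓝 0))
    (htop : Filter.Tendsto (rho q₀ q₁ b₀ b₁) Filter.atTop Filter.atTop) :
    kInterpSpace (besovSpace E 𝕜 q₀ b₀) (besovSpace E 𝕜 q₁ b₁)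
        (besovNorm E q₀ b₀) (besovNorm E q₁ b₁) θ q b =
      besovSpace E 𝕜 q (bTilde θ q q₀ q₁ b b₀ b₁) ∧
    ∃ C : ℝ≥0, ∀ f ∈ besovSpace E 𝕜 q (bTilde θ q q₀ q₁ b b₀ b₁),
      kInterpNorm (besovSpace E 𝕜 q₀ b₀) (besovSpace E 𝕜 q₁ b₁)
          (besovNorm E q₀ b₀) (besovNorm E q₁ b₁) θ q b f ≤
        C * besovNorm E q (bTilde θ q q₀ q₁ b b₀ b₁) f ∧
      besovNorm E q (bTilde θ q q₀ q₁ b b₀ b₁) f ≤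
        C * kInterpNorm (besovSpace E 𝕜 q₀ b₀) (besovSpace E 𝕜 q₁ b₁)
          (besovNorm E q₀ b₀) (besovNorm E q₁ b₁) θ q b f :=
  mainTheorem12_general E q₀ q₁ q θ hq₀ hq₁ hq hθ₀ hθ₁ b₀ b₁ b hb₀ hb₁ hb hcond hmono hzero htop
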